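/- Let $\mu$ be a probability measure on $\mathbb{R}/2\pi\mathbb{Z}$ that is not supported on a finite number of points. Let $\Phi_n(z)$, $n\ge 0$, be its monic orthogonal polynomials, that is, $\Phi_n$ is monic of degree $n$ and $\int \overline{\Phi_m(e^{i\eta})}\,\Phi_n(e^{i\eta})\,d\mu(\eta)=0$ for $m\ne n$. Let $\{\alpha_n\}_{n\ge 0}$ be the Verblunsky coefficients of $\mu$, that is, the coefficients in the Szegő recursion $$\Phi_{n+1}(z)=z\,\Phi_n(z)-\overline{\alpha_n}\,\Phi_n^*(z),\qquad \Phi_n^*(z)=z^n\,\overline{\Phi_n(1/\overline z)} .$$ For $\beta\in[0,2\pi)$ let $\Phi_n(z,\beta)$ be the monic polynomials generated by the same recursion from $\Phi_0(z,\beta)=1$ with the coefficients $e^{i\beta}\alpha_n$ in place of $\alpha_n$. For $\eta\in[0,2\pi)$ let $R_n(\eta,\beta)=|\Phi_n(e^{i\eta},\beta)|$ be the Prüfer radius, i.e. $\Phi_n(e^{i\eta},\beta)=R_n(\eta,\beta)\exp[i(n\eta+\theta_n(\eta,\beta))]$ with $R_n>0$ and $\theta_n$ real. Assume that there is $A<\infty$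 such that $$\sum_{n=0}^{N}(n+1)|\alpha_n|^2\le A\log N\qquad\text{for all integers } N\ge 2 .$$ Then the set $$S=\{\eta\in[0,2\pi): R_n(\eta,\beta)\text{ is unbounded in } n\text{ for some }\beta\in[0,2\pi)\}$$ has Hausdorff dimension zero. Consequently, the singular part $\mu_{\rm sing}$ of $\mu$ with respect to Lebesgue measure is supported on a set of Hausdorff dimension zero: there is a Borel set $T\subseteq\mathbb{R}/2\pi\mathbb{Z}$ of Hausdorff dimension zero with $\mu_{\rm sing}\bigl((\mathbb{R}/2\pi\mathbb{Z})\setminus T\bigr)=0$. -/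

import Mathlib

open MeasureTheory Polynomial

instance factTwoPiPos : Fact (0 < 2 * Real.pi) := ⟨Real.two_pi_pos⟩

/-- The reversed polynomial `P^*(z) = z ^ n * conj (P (1 / conj z))` of a polynomial `P` of degree
at most `n`: its `k`-th coefficient is the conjugate of the `(n - k)`-th coefficient of `P`. -/
noncomputable def reversedPoly (n : ℕ) (P : ℂ[X]) : ℂ[X] :=
  (P.map (starRingEnd ℂ)).reflect n

theorem eval_reversedPoly {n : ℕ} {P : ℂ[X]} (hP : P.natDegree ≤ n) {z : ℂ} (hz : z ≠ 0) :
    (reversedPoly n P).eval z = z ^ n * starRingEnd ℂ (P.eval (1 / starRingEnd ℂ z)) := by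
  have hQ : (P.map (starRingEnd ℂ)).natDegree ≤ n := natDegree_map_le.trans hP
  have h : starRingEnd ℂ (P.eval (1 / starRingEnd ℂ z)) =
      (P.map (starRingEnd ℂ)).eval z⁻¹ := by
    have := eval_map_apply (p := P) (starRingEnd ℂ) (1 / starRingEnd ℂ z)
    rw [← this]
    simp
  have hz' : z⁻¹ ≠ 0 := inv_ne_zero hz
  let : Invertible z⁻¹ := invertibleOfNonzero hz'
  have hr := eval₂_reflect_mul_pow (RingHom.id ℂ) z⁻¹ n _ hQ
  rw [invOf_eq_inv, inv_inv] at hr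
  rw [h, reversedPoly, eval, eval, ← hr, mul_comm, mul_assoc, ← mul_pow, inv_mul_cancel₀ hz,
    one_pow, mul_one]

/-- The sequence `Φ` consists of the monic orthogonal polynomials of the measure `μ` on
`ℝ / 2πℤ`: `Φ n` is monic of degree `n`, and `∫ conj (Φ m (e^{iη})) * Φ n (e^{iη}) dμ(η) = 0`
for `m ≠ n`. Here `AddCircle.toCircle η` is `e^{iη}`. -/
def IsMonicOrthogonal (μ : Measure (AddCircle (2 * Real.pi))) (Φ : ℕ → ℂ[X]) : Prop :=
  (∀ n, (Φ n).Monic ∧ (Φ n).natDegree = n) ∧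
    ∀ m n, m ≠ n →
      ∫ η, starRingEnd ℂ ((Φ m).eval (AddCircle.toCircle η : ℂ)) *
        (Φ n).eval (AddCircle.toCircle η : ℂ) ∂μ = 0

/-- `α` is the sequence of Verblunsky coefficients of `μ`: the monic orthogonal polynomials of `μ`
obey the Szegő recursion `Φ_{n+1}(z) = z Φ_n(z) - conj α_n Φ_n^*(z)`. -/
def IsVerblunsky (μ : Measure (AddCircle (2 * Real.pi))) (α : ℕ → ℂ) : Prop :=
  ∃ Φ : ℕ → ℂ[X], IsMonicOrthogonal μ Φ ∧
    ∀ n, Φ (n + 1) = X * Φ n - C (starRingEnd ℂ (α n)) * reversedPoly n (Φ n)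

/-- The monic polynomials generated from coefficients `α` by the Szegő recursion. -/
noncomputable def szegoPoly (α : ℕ → ℂ) : ℕ → ℂ[X]
  | 0 => 1
  | n + 1 => X * szegoPoly α n - C (starRingEnd ℂ (α n)) * reversedPoly n (szegoPoly α n)

/-- The polynomials `Φ_n(z, β)`, associated with the coefficients `e^{iβ} α_n`. -/
noncomputable def rotatedPoly (α : ℕ → ℂ) (β : ℝ) : ℕ → ℂ[X] :=
  szegoPoly fun n => Complex.exp (Complex.I * β) * α n

/-- The Prüfer radius `R_n(η, β)`. It is the modulus of `Φ_n(e^{iη}, β)`, because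
`Φ_n(e^{iη}, β) = R_n(η, β) exp (i (n η + θ_n(η, β)))` with `R_n > 0` and `θ_n` real. -/
noncomputable def pruferRadius (α : ℕ → ℂ) (n : ℕ) (η β : ℝ) : ℝ :=
  ‖(rotatedPoly α β n).eval (Complex.exp (Complex.I * η))‖

/-- The set of those `η ∈ [0, 2π)` for which `R_n(η, β)` is unbounded in `n` for some
`β ∈ [0, 2π)`. -/
def unboundedSet (α : ℕ → ℂ) : Set ℝ :=
  {η | η ∈ Set.Ico 0 (2 * Real.pi) ∧ ∃ β ∈ Set.Ico 0 (2 * Real.pi),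
    ¬ BddAbove (Set.range fun n => pruferRadius α n η β)}

/-! On the circle the Prüfer equations read `R_{n+1} = R_n |1 - t_n|` with `t_n = α_n z^n p_n`,
where the phase `p_n` is unimodular and moves by at most `4|α_n|` per step. As `∑ |α_n|²` converges,
`R_n` can be unbounded only if the partial sums of `t_n` are, hence only if for infinitely many `k`
some initial piece of the block `[4^k, 4^(k+1))` has a sum exceeding the summable threshold
`1/(k+1)²`. Replacing `α` by `e^{iβ} α` merely rotates `p`, so one exceptional set serves all `β`.

Few separated points are exceptional at level `k`. The hypothesis makes the block sum of `|α_n|²` at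
most a constant times `(k+1)/4^k`; by Cauchy-Schwarz that of `|α_n|`, hence the variation of the
phases, is `O(k+1)`. Abel summation then makes the vectors `z^n p_n` of two points at distance at
least `2^{-k}` almost orthogonal: their inner product is `O((k+1) 2^k)`, against squared norms up to
`3·4^k`. A Bessel inequality excludes `(k+1)^6` such points for large `k`. So level `k` is covered
by `(k+1)^6` balls of radius `2^{-k}`, and a Borel-Cantelli argument gives dimension zero
(`dimH_frequently_mem_eq_zero`, `card_ne_of_separated_largeSumSet`, `bddAbove_pruferRadius`).

For the singular part, suppose that the polynomials of the first and second kind (`β = 0` and `β =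
π`) are both bounded at `ζ`. Their Wronskian stays away from zero, and variation of constants keeps
`Φ_j`, `j < n`, close to `Φ_j(ζ)` on an arc of radius `δ/n`. Testing `μ` against the kernel `∑
conj(Φ_j(ζ)) Φ_j` bounds the mass of this arc by `O(1/n)` (`exists_measure_closedBall_le`). A
measure of finite upper density on a Lebesgue null set does not charge it, so `μ_sing` lives where
one of the two families is unbounded, inside the image of `S`. -/

/-! ### Covering criterion for Hausdorff dimension zero -/

/-- A set either has a separated subset with `n` points or is covered by at most `n` balls. -/
theorem exists_separated_or_cover {X : Type*} [MetricSpace X] (B : Set X) {r : ℝ} (hr : 0 ≤ r)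
    (n : ℕ) :
    (∃ F : Finset X, ↑F ⊆ B ∧ (∀ x ∈ F, ∀ y ∈ F, x ≠ y → r ≤ dist x y) ∧ F.card = n) ∨
      ∃ F : Finset X, F.card ≤ n ∧ B ⊆ ⋃ x ∈ F, Metric.closedBall x r := by
  classical
  induction n with
  | zero => exact Or.inl ⟨∅, by simp⟩
  | succ n ih =>
    rcases ih with ⟨F, hFB, hF, hc⟩ | ⟨F, hc, hF⟩
    · by_cases hcov : B ⊆ ⋃ x ∈ F, Metric.closedBall x r
      · exact Or.inr ⟨F, by omega, hcov⟩
      · obtain ⟨y, hyB, hy⟩ := Set.not_subset.1 hcov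
        simp only [Set.mem_iUnion, Metric.mem_closedBall, exists_prop, not_exists, not_and,
          not_le] at hy
        have hyF : y ∉ F := fun h => by
          have := hy y h
          rw [dist_self] at this
          linarith
        left
        refine ⟨insert y F, ?_, ?_, ?_⟩
        · intro x hx
          rcases Finset.mem_insert.1 (Finset.mem_coe.1 hx) with rfl | hx
          · exact hyB
          · exact hFB hx
        · intro a ha b hb hab
          rcases Finset.mem_insert.1 ha with rfl | ha <;>
            rcases Finset.mem_insert.1 hb with rfl | hb
          · exact absurd rfl hab
          · exact (hy b hb).le
          · rw [dist_comm]; exact (hy a (by assumption)).le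
          · exact hF a ha b hb hab
        · rw [Finset.card_insert_of_notMem hyF, hc]
    · exact Or.inr ⟨F, by omega, hF⟩

theorem tsum_pow_mul_rpow_ne_top {d : ℝ} (hd : 0 < d) :
    ∑' k : ℕ, ((k + 1) ^ 6 : ℕ) * ENNReal.ofReal (2 * (1 / 2) ^ k) ^ d ≠ ⊤ := by
  have h1 : ∀ k : ℕ, (((k + 1) ^ 6 : ℕ) : ENNReal) * ENNReal.ofReal (2 * (1 / 2) ^ k) ^ d =
      ENNReal.ofReal (((k + 1) ^ 6 : ℕ) * (2 ^ d * ((1 / 2) ^ d) ^ k)) := by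
    intro k
    rw [ENNReal.ofReal_mul (Nat.cast_nonneg _), ENNReal.ofReal_natCast,
      ENNReal.ofReal_rpow_of_nonneg (by positivity) hd.le,
      Real.mul_rpow (by norm_num) (by positivity), ← Real.rpow_natCast, ← Real.rpow_natCast,
      ← Real.rpow_mul (by norm_num), ← Real.rpow_mul (by norm_num), mul_comm (k : ℝ)]
  have hr : ‖((1 / 2 : ℝ) ^ d)‖ < 1 := by
    rw [Real.norm_of_nonneg (by positivity)]
    exact Real.rpow_lt_one (by norm_num) (by norm_num) hd
  have hpos : (0 : ℝ) < (1 / 2) ^ d := by positivity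
  have hs : Summable fun k : ℕ => (((k + 1) ^ 6 : ℕ) : ℝ) * (2 ^ d * ((1 / 2) ^ d) ^ k) := by
    have hs := (summable_nat_add_iff (f := fun k : ℕ => (k : ℝ) ^ 6 * ((1 / 2 : ℝ) ^ d) ^ k) 1).2
      (summable_pow_mul_geometric_of_norm_lt_one 6 hr)
    refine (hs.mul_left (2 ^ d * ((1 / 2) ^ d)⁻¹)).congr fun k => ?_
    generalize (1 / 2 : ℝ) ^ d = q at hpos ⊢
    rw [pow_succ q k, Nat.cast_pow]
    field_simp
  rw [tsum_congr h1]
  exact hs.tsum_ofReal_ne_top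

/-- The points that lie in infinitely many of the sets `B k` form a set of dimension zero, if
each `B k` contains only polynomially many points with mutual distances at least `2⁻ᵏ`. -/
theorem dimH_frequently_mem_eq_zero {X : Type*} [MetricSpace X] (B : ℕ → Set X)
    (hB : ∀ᶠ k in Filter.atTop, ∀ F : Finset X, ↑F ⊆ B k →
      (∀ x ∈ F, ∀ y ∈ F, x ≠ y → (1 / 2 : ℝ) ^ k ≤ dist x y) → F.card ≠ (k + 1) ^ 6) :
    dimH {x | ∃ᶠ k in Filter.atTop, x ∈ B k} = 0 := by
  borelize X
  obtain ⟨K, hK⟩ := Filter.eventually_atTop.1 hB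
  have hcov : ∀ k, ∃ F : Finset X, F.card ≤ (k + 1) ^ 6 ∧
      (K ≤ k → B k ⊆ ⋃ x ∈ F, Metric.closedBall x ((1 / 2) ^ k)) := by
    intro k
    by_cases hk : K ≤ k
    · rcases exists_separated_or_cover (B k) (r := (1 / 2 : ℝ) ^ k) (by positivity)
        ((k + 1) ^ 6) with ⟨F, h1, h2, h3⟩ | ⟨F, h1, h2⟩
      · exact absurd h3 (hK k hk F h1 h2)
      · exact ⟨F, h1, fun _ => h2⟩
    · exact ⟨∅, by simp, fun h => absurd h hk⟩
  choose F hFc hF using hcov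
  have key : ∀ d : NNReal, 0 < d → μH[d] {x | ∃ᶠ k in Filter.atTop, x ∈ B k} = 0 := by
    intro d hd
    have hd' : (0 : ℝ) < d := by exact_mod_cast hd
    have hdiam : ∀ (k : ℕ) (x : X), Metric.ediam (Metric.closedBall x ((1 / 2 : ℝ) ^ k)) ≤
        ENNReal.ofReal (2 * (1 / 2) ^ k) := by
      intro k x
      refine Metric.ediam_le_of_forall_dist_le fun a ha b hb => ?_
      linarith [dist_triangle_right a b x, Metric.mem_closedBall.1 ha, Metric.mem_closedBall.1 hb]
    -- The `n`-th cover uses the balls of all levels `n + j`, so its cost is the tail of a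
    -- convergent series.
    have hle := Measure.hausdorffMeasure_le_liminf_tsum (ι := fun n => Σ j : ℕ, F (n + j))
      (d : ℝ) {x | ∃ᶠ k in Filter.atTop, x ∈ B k} (l := Filter.atTop)
      (fun n : ℕ => ENNReal.ofReal (2 * (1 / 2) ^ n)) ?_
      (fun n p => Metric.closedBall (p.2 : X) ((1 / 2) ^ (n + p.1))) ?_ ?_
    · refine le_antisymm (hle.trans ?_) zero_le
      have htail := ENNReal.tendsto_sum_nat_add _ (tsum_pow_mul_rpow_ne_top hd')
      rw [← htail.liminf_eq]
      refine Filter.liminf_le_liminf (Filter.Eventually.of_forall fun n => ?_)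
      rw [ENNReal.tsum_sigma']
      refine ENNReal.tsum_le_tsum fun j => ?_
      rw [tsum_fintype, add_comm j n]
      calc _ ≤ ∑ _x : F (n + j), ENNReal.ofReal (2 * (1 / 2) ^ (n + j)) ^ (d : ℝ) :=
            Finset.sum_le_sum fun x _ => ENNReal.rpow_le_rpow (hdiam _ _) hd'.le
        _ ≤ _ := by
            rw [Finset.sum_const, nsmul_eq_mul, Finset.card_univ, Fintype.card_coe]
            gcongr
            exact hFc (n + j)
    · have h := (tendsto_pow_atTop_nhds_zero_of_lt_one (r := (1 / 2 : ℝ)) (by norm_num)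
        (by norm_num)).const_mul 2
      simpa using ENNReal.tendsto_ofReal h
    · refine Filter.Eventually.of_forall fun n p => (hdiam _ _).trans ?_
      refine ENNReal.ofReal_le_ofReal ?_
      have := pow_le_pow_of_le_one (a := (1 / 2 : ℝ)) (by norm_num) (by norm_num)
        (Nat.le_add_right n p.1)
      linarith
    · filter_upwards [Filter.eventually_ge_atTop K] with n hn x hx
      obtain ⟨k, hk, hxk⟩ := (Filter.frequently_atTop.1 hx) n
      have := hF k (hn.trans hk) hxk
      simp only [Set.mem_iUnion] at this
      obtain ⟨y, hy, hxy⟩ := this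
      obtain ⟨j, rfl⟩ := Nat.exists_eq_add_of_le hk
      exact Set.mem_iUnion.2 ⟨⟨j, y, hy⟩, hxy⟩
  refine le_antisymm (ENNReal.le_of_forall_pos_le_add fun ε hε _ => ?_) zero_le
  rw [zero_add]
  exact dimH_le_of_hausdorffMeasure_ne_top (by rw [key ε hε]; exact ENNReal.zero_ne_top)

/-! ### Abel summation and almost orthogonality -/

/-- Summation by parts for a geometric sequence with a slowly varying amplitude. -/
theorem norm_sum_pow_mul_le {w : ℂ} (hw : ‖w‖ = 1) (q : ℕ → ℂ) (hq : ∀ n, ‖q n‖ ≤ 1)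
    (a b : ℕ) (hab : a ≤ b) :
    ‖w - 1‖ * ‖∑ n ∈ Finset.Ico a b, w ^ n * q n‖ ≤
      2 + ∑ n ∈ Finset.Ico a b, ‖q (n + 1) - q n‖ := by
  have h : (w - 1) * ∑ n ∈ Finset.Ico a b, w ^ n * q n =
      (w ^ b * q b - w ^ a * q a) - ∑ n ∈ Finset.Ico a b, w ^ (n + 1) * (q (n + 1) - q n) := by
    rw [← Finset.sum_Ico_sub (fun n => w ^ n * q n) hab, ← Finset.sum_sub_distrib,
      Finset.mul_sum]
    refine Finset.sum_congr rfl fun n _ => ?_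
    ring
  rw [← norm_mul, h]
  refine (norm_sub_le _ _).trans (add_le_add ((norm_sub_le _ _).trans ?_)
    ((norm_sum_le _ _).trans (Finset.sum_le_sum fun n _ => ?_)))
  · rw [norm_mul, norm_mul, norm_pow, norm_pow, hw, one_pow, one_pow, one_mul, one_mul]
    linarith [hq a, hq b]
  · rw [norm_mul, norm_pow, hw, one_pow, one_mul]

/-- A Bessel type inequality for almost orthogonal families. -/
theorem sq_card_mul_le_of_almost_orthogonal {ι κ : Type*} [DecidableEq ι] (J : Finset ι)
    (I : Finset κ) (f : ι → κ → ℂ) (a : κ → ℂ) {L G τ : ℝ} (hτ : 0 ≤ τ) (hG : 0 ≤ G)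
    (hL : ∀ i ∈ J, ∑ n ∈ I, ‖f i n‖ ^ 2 ≤ L)
    (hfG : ∀ i ∈ J, ∀ j ∈ J, i ≠ j → ‖∑ n ∈ I, f i n * starRingEnd ℂ (f j n)‖ ≤ G)
    (hS : ∀ i ∈ J, τ ≤ ‖∑ n ∈ I, a n * f i n‖) :
    (J.card * τ) ^ 2 ≤ (∑ n ∈ I, ‖a n‖ ^ 2) * (J.card * L + J.card ^ 2 * G) := by
  -- Unimodular factors align the sums, so that their moduli add up to one pairing of `a` with `g =
  -- ∑ c_i f_i`, to which Cauchy-Schwarz applies.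
  have hc : ∀ s : ℂ, ∃ c : ℂ, ‖c‖ = 1 ∧ c * s = ‖s‖ := by
    intro s
    by_cases hs : s = 0
    · exact ⟨1, by simp, by simp [hs]⟩
    · refine ⟨‖s‖ / s, ?_, by field_simp⟩
      rw [norm_div, Complex.norm_real, norm_norm, div_self (norm_ne_zero_iff.2 hs)]
  choose c hc1 hc2 using fun i => hc (∑ n ∈ I, a n * f i n)
  set g : κ → ℂ := fun n => ∑ i ∈ J, c i * f i n with hg
  have h1 : (J.card : ℝ) * τ ≤ ‖∑ n ∈ I, a n * g n‖ := by
    have : ∑ n ∈ I, a n * g n = ((∑ i ∈ J, ‖∑ n ∈ I, a n * f i n‖ : ℝ) : ℂ) := by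
      rw [Complex.ofReal_sum]
      simp_rw [← hc2, hg, Finset.mul_sum]
      rw [Finset.sum_comm]
      refine Finset.sum_congr rfl fun i _ => Finset.sum_congr rfl fun n _ => ?_
      ring
    rw [this, Complex.norm_real, Real.norm_of_nonneg (Finset.sum_nonneg fun _ _ => norm_nonneg _),
      ← nsmul_eq_mul]
    exact Finset.card_nsmul_le_sum _ _ _ hS
  have h2 : ‖∑ n ∈ I, a n * g n‖ ^ 2 ≤ (∑ n ∈ I, ‖a n‖ ^ 2) * ∑ n ∈ I, ‖g n‖ ^ 2 := by
    refine le_trans ?_ (Finset.sum_mul_sq_le_sq_mul_sq I (fun n => ‖a n‖) fun n => ‖g n‖)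
    gcongr
    exact (norm_sum_le _ _).trans_eq (Finset.sum_congr rfl fun n _ => norm_mul _ _)
  have h3 : ∑ n ∈ I, ‖g n‖ ^ 2 ≤ J.card * L + J.card ^ 2 * G := by
    have e : ((∑ n ∈ I, ‖g n‖ ^ 2 : ℝ) : ℂ) = ∑ i ∈ J, ∑ j ∈ J,
        (c i * starRingEnd ℂ (c j)) * ∑ n ∈ I, f i n * starRingEnd ℂ (f j n) := by
      rw [Complex.ofReal_sum]
      simp_rw [Complex.ofReal_pow, ← Complex.mul_conj', hg, map_sum, Finset.sum_mul_sum,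
        Finset.mul_sum]
      rw [Finset.sum_comm]
      refine Finset.sum_congr rfl fun i _ => ?_
      rw [Finset.sum_comm]
      refine Finset.sum_congr rfl fun j _ => Finset.sum_congr rfl fun n _ => ?_
      rw [map_mul]
      ring
    have hL' : ∀ i ∈ J, ‖∑ n ∈ I, f i n * starRingEnd ℂ (f i n)‖ ≤ L := by
      intro i hi
      refine le_trans ?_ (hL i hi)
      refine (norm_sum_le _ _).trans_eq (Finset.sum_congr rfl fun n _ => ?_)
      rw [norm_mul, RCLike.norm_conj, sq]
    have hL0 : ∀ i ∈ J, 0 ≤ L := fun i hi => (norm_nonneg _).trans (hL' i hi)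
    calc ∑ n ∈ I, ‖g n‖ ^ 2 = ‖((∑ n ∈ I, ‖g n‖ ^ 2 : ℝ) : ℂ)‖ := by
          rw [Complex.norm_real, Real.norm_of_nonneg (Finset.sum_nonneg fun _ _ => by positivity)]
      -- `G` is also added on the diagonal, which makes the double sum exactly `|J| L + |J|² G`.
      _ ≤ ∑ i ∈ J, ∑ j ∈ J, ((if i = j then L else 0) + G) := by
          rw [e]
          refine (norm_sum_le _ _).trans (Finset.sum_le_sum fun i hi => ?_)
          refine (norm_sum_le _ _).trans (Finset.sum_le_sum fun j hj => ?_)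
          rw [norm_mul, norm_mul, RCLike.norm_conj, hc1, hc1, one_mul, one_mul]
          split_ifs with hij
          · subst hij; linarith [hL' i hi]
          · linarith [hfG i hi j hj hij]
      _ = _ := by
          simp only [Finset.sum_add_distrib, Finset.sum_ite_eq, Finset.sum_const, nsmul_eq_mul]
          rw [Finset.sum_congr rfl fun i hi => if_pos hi]
          simp only [Finset.sum_const, nsmul_eq_mul]
          ring
  calc ((J.card : ℝ) * τ) ^ 2 ≤ ‖∑ n ∈ I, a n * g n‖ ^ 2 := by gcongr
    _ ≤ _ := h2.trans (by gcongr)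

/-! ### Large block sums at separated points -/

/-- The points on an arc at which some partial sum over the block `[4 ^ k, 4 ^ (k + 1))` of
`α n * z ^ n`, modulated by slowly varying phases, is large. -/
def largeSumSet (α : ℕ → ℂ) (a : ℝ) (k : ℕ) : Set ℝ :=
  {η | η ∈ Set.Icc a (a + Real.pi) ∧ ∃ p : ℕ → ℂ, (∀ n, ‖p n‖ = 1) ∧
    (∀ n, ‖p (n + 1) - p n‖ ≤ 4 * ‖α n‖) ∧ ∃ m, 4 ^ k ≤ m ∧ m ≤ 4 ^ (k + 1) ∧
      1 / ((k : ℝ) + 1) ^ 2 <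
        ‖∑ n ∈ Finset.Ico (4 ^ k) m, α n * (Complex.exp (Complex.I * η) ^ n * p n)‖}

/-- The chord is `2 sin (d/2) ≥ 2d/π`. Restricting to a half circle prevents distant parameters from
giving nearby points. -/
theorem half_dist_le_norm_exp_sub_exp {a x y : ℝ} (hx : x ∈ Set.Icc a (a + Real.pi))
    (hy : y ∈ Set.Icc a (a + Real.pi)) :
    dist x y / 2 ≤ ‖Complex.exp (Complex.I * x) - Complex.exp (Complex.I * y)‖ := by
  have h : Complex.exp (Complex.I * x) - Complex.exp (Complex.I * y) =
      Complex.exp (Complex.I * y) * (Complex.exp (Complex.I * ((x - y : ℝ) : ℂ)) - 1) := by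
    rw [mul_sub, ← Complex.exp_add, mul_one]
    push_cast
    ring_nf
  have hpi : |x - y| ≤ Real.pi := abs_le.2 ⟨by linarith [hx.1, hy.2], by linarith [hx.2, hy.1]⟩
  rw [h, norm_mul, mul_comm Complex.I, Complex.norm_exp_ofReal_mul_I, one_mul,
    Complex.norm_exp_I_mul_ofReal_sub_one, Real.dist_eq, Real.norm_eq_abs, abs_mul,
    abs_of_pos (show (0 : ℝ) < 2 by norm_num)]
  have h1 : |Real.sin ((x - y) / 2)| = Real.sin (|x - y| / 2) := by
    rcases abs_cases (x - y) with ⟨e, h0⟩ | ⟨e, h0⟩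
    · rw [e, abs_of_nonneg]
      apply Real.sin_nonneg_of_nonneg_of_le_pi <;> linarith [Real.pi_pos]
    · rw [e, neg_div, Real.sin_neg, abs_of_nonpos]
      apply Real.sin_nonpos_of_nonpos_of_neg_pi_le <;> linarith [Real.pi_pos]
  rw [h1]
  have h2 := Real.mul_le_sin (x := |x - y| / 2) (by positivity) (by linarith)
  have h3 : (1 : ℝ) / 2 ≤ 2 / Real.pi := by
    rw [div_le_div_iff₀ (by norm_num) Real.pi_pos]
    linarith [Real.pi_le_four]
  have h4 : |x - y| / 2 * (1 / 2) ≤ |x - y| / 2 * (2 / Real.pi) := by gcongr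
  linarith

/-- This fixes the exponent 6. With `x = k + 1`, `x^6` points and threshold `x^{-2}`, the right side
is `x^8`, while the left side is a diagonal term `3C x^7` plus an off-diagonal term of order `x^14 /
2^k`. -/
theorem eventually_lt_of_polynomial_growth (C : ℝ) :
    ∀ᶠ k : ℕ in Filter.atTop, C * (k + 1) / 4 ^ k * (((k + 1) ^ 6 : ℕ) * (3 * 4 ^ k) +
      ((k + 1) ^ 6 : ℕ) ^ 2 * (2 * 2 ^ k * (10 + 24 * (C * (k + 1))))) <
        (((k + 1) ^ 6 : ℕ) * (1 / ((k : ℝ) + 1) ^ 2)) ^ 2 := by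
  have h1 : Filter.Tendsto (fun k : ℕ => (k : ℝ) ^ 6 / 2 ^ k) Filter.atTop (nhds 0) :=
    tendsto_pow_const_div_const_pow_of_one_lt 6 (by norm_num)
  have h1' := ((Filter.tendsto_add_atTop_iff_nat 1).2 h1).mul_const (2 * |C| * (20 + 48 * |C|))
  have h2 : Filter.Tendsto (fun k : ℕ => 3 * |C| / ((k : ℝ) + 1)) Filter.atTop (nhds 0) :=
    tendsto_const_nhds.div_atTop (Filter.tendsto_atTop_add_const_right _ _ tendsto_natCast_atTop_atTop)
  have h3 := h2.add h1'
  rw [zero_mul, add_zero] at h3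
  filter_upwards [h3.eventually (gt_mem_nhds zero_lt_one)] with k hk
  have h4 : (4 : ℝ) ^ k = 2 ^ k * 2 ^ k := by rw [← mul_pow]; norm_num
  have hC : C ≤ |C| := le_abs_self C
  have hx : (1 : ℝ) ≤ (k : ℝ) + 1 := by linarith [(Nat.cast_nonneg k : (0 : ℝ) ≤ k)]
  push_cast at hk ⊢
  set x : ℝ := (k : ℝ) + 1
  have ht : (0 : ℝ) < 2 ^ k := by positivity
  rw [pow_succ (2 : ℝ) k] at hk
  set t : ℝ := 2 ^ k
  have hx0 : 0 < x := by linarith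
  have e1 : C * x / 4 ^ k * (x ^ 6 * (3 * 4 ^ k) + (x ^ 6) ^ 2 * (2 * t * (10 + 24 * (C * x)))) =
      3 * C * x ^ 7 + C * x ^ 13 * (20 + 48 * (C * x)) / t := by
    rw [h4]; field_simp; ring
  have e2 : (x ^ 6 * (1 / x ^ 2)) ^ 2 = x ^ 8 := by field_simp
  rw [e1, e2]
  have e3 : C * x ^ 13 * (20 + 48 * (C * x)) ≤ |C| * (20 + 48 * |C|) * x ^ 14 := by
    have : C * (20 + 48 * (C * x)) ≤ |C| * (20 + 48 * |C|) * x := by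
      have hcc : C * C = |C| * |C| := (abs_mul_abs_self C).symm
      nlinarith [abs_nonneg C, mul_nonneg (abs_nonneg C) (sub_nonneg.2 hx)]
    calc _ = C * (20 + 48 * (C * x)) * x ^ 13 := by ring
      _ ≤ |C| * (20 + 48 * |C|) * x * x ^ 13 := by gcongr
      _ = _ := by ring
  calc 3 * C * x ^ 7 + C * x ^ 13 * (20 + 48 * (C * x)) / t
      ≤ 3 * |C| * x ^ 7 + |C| * (20 + 48 * |C|) * x ^ 14 / t := by gcongr
    _ = (3 * |C| / x + x ^ 6 / (t * 2) * (2 * |C| * (20 + 48 * |C|))) * x ^ 8 := by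
        field_simp
    _ < 1 * x ^ 8 := by gcongr
    _ = x ^ 8 := one_mul _

theorem norm_unimodular_sub_one {z w : ℂ} (hw : ‖w‖ = 1) :
    ‖z * starRingEnd ℂ w - 1‖ = ‖z - w‖ := by
  have h : z * starRingEnd ℂ w - 1 = (z - w) * starRingEnd ℂ w := by
    rw [sub_mul, Complex.mul_conj', hw]; simp
  rw [h, norm_mul, RCLike.norm_conj, hw, mul_one]

theorem norm_mul_conj_sub_mul_conj_le {a b c d : ℂ} (hc : ‖c‖ = 1) (hb : ‖b‖ = 1) :
    ‖a * starRingEnd ℂ c - b * starRingEnd ℂ d‖ ≤ ‖a - b‖ + ‖c - d‖ := by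
  have h : a * starRingEnd ℂ c - b * starRingEnd ℂ d =
      (a - b) * starRingEnd ℂ c + b * starRingEnd ℂ (c - d) := by rw [map_sub]; ring
  rw [h]
  refine (norm_add_le _ _).trans_eq ?_
  rw [norm_mul, norm_mul, RCLike.norm_conj, RCLike.norm_conj, hc, hb, mul_one, one_mul]

/-- A separated set of points with large block sums is small. -/
theorem card_ne_of_separated_largeSumSet (α : ℕ → ℂ) (a C : ℝ)
    (hC : ∀ k : ℕ, (∑ n ∈ Finset.Ico (4 ^ k) (4 ^ (k + 1)), ‖α n‖ ^ 2) ≤ C * (k + 1) / 4 ^ k) :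
    ∀ᶠ k in Filter.atTop, ∀ F : Finset ℝ, ↑F ⊆ largeSumSet α a k →
      (∀ x ∈ F, ∀ y ∈ F, x ≠ y → (1 / 2 : ℝ) ^ k ≤ dist x y) → F.card ≠ (k + 1) ^ 6 := by
  filter_upwards [eventually_lt_of_polynomial_growth C] with k hk F hF hsep hcard
  have hFa : ∀ x ∈ F, x ∈ Set.Icc a (a + Real.pi) := fun x hx => (hF hx).1
  have hFp := fun x (hx : x ∈ F) => (hF hx).2
  choose! p hp1 hp2 m hm1 hm2 hS using hFp
  set I := Finset.Ico (4 ^ k) (4 ^ (k + 1)) with hI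
  set s := ∑ n ∈ I, ‖α n‖ ^ 2 with hs
  have hs0 : 0 ≤ s := Finset.sum_nonneg fun _ _ => by positivity
  have h4 : (0 : ℝ) < 4 ^ k := by positivity
  have hb0 : 0 ≤ C * (k + 1) := by
    have := (hs0.trans (hC k))
    rwa [le_div_iff₀ h4, zero_mul] at this
  have hIcard : (I.card : ℝ) = 3 * 4 ^ k := by
    rw [hI, Nat.card_Ico, Nat.cast_sub (Nat.pow_le_pow_right (by norm_num) (Nat.le_succ k))]
    rw [pow_succ]
    push_cast
    ring
  -- Cauchy-Schwarz bounds the square of the sum by `y = 3C(k+1)`; then `√y ≤ 1 + y`.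
  have hl1 : ∑ n ∈ I, ‖α n‖ ≤ 1 + 3 * (C * (k + 1)) := by
    have h := sq_sum_le_card_mul_sum_sq (s := I) (f := fun n => ‖α n‖)
    rw [hIcard] at h
    have h' : 3 * 4 ^ k * s ≤ 3 * (C * (k + 1)) := by
      have := (le_div_iff₀ h4).1 (hC k)
      linarith
    have h0 : 0 ≤ ∑ n ∈ I, ‖α n‖ := Finset.sum_nonneg fun _ _ => norm_nonneg _
    nlinarith
  set z : ℝ → ℂ := fun x => Complex.exp (Complex.I * x) with hz
  have hz1 : ∀ x, ‖z x‖ = 1 := fun x => by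
    simp only [hz]; rw [mul_comm]; exact Complex.norm_exp_ofReal_mul_I x
  -- The cutoff `m x` depends on the point; truncating by zero puts all vectors on the same block,
  -- and inner products run up to `min (m x) (m y)`.
  set f : ℝ → ℕ → ℂ := fun x n => if n < m x then z x ^ n * p x n else 0 with hf
  have hfsum : ∀ x ∈ F, ∑ n ∈ I, α n * f x n =
      ∑ n ∈ Finset.Ico (4 ^ k) (m x), α n * (z x ^ n * p x n) := by
    intro x hx
    simp only [hf, mul_ite, mul_zero]
    rw [← Finset.sum_filter, hI, Finset.Ico_filter_lt, min_eq_right (hm2 x hx)]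
  have hmain := sq_card_mul_le_of_almost_orthogonal F I f α (L := 3 * 4 ^ k)
    (G := 2 * 2 ^ k * (10 + 24 * (C * (k + 1)))) (τ := 1 / ((k : ℝ) + 1) ^ 2)
    (by positivity) (by positivity) ?_ ?_ ?_
  · rw [hcard] at hmain
    refine absurd (hk.trans_le hmain) (not_lt.2 ?_)
    gcongr
    exact hC k
  · intro x hx
    rw [← hIcard, ← nsmul_one, ← Finset.sum_const]
    refine Finset.sum_le_sum fun n _ => ?_
    simp only [hf]
    split_ifs
    · rw [norm_mul, norm_pow, hz1, hp1 x hx]; simp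
    · simp
  · intro x hx y hy hxy
    set b := min (m x) (m y) with hbdef
    have hb1 : 4 ^ k ≤ b := le_min (hm1 x hx) (hm1 y hy)
    have hb2 : b ≤ 4 ^ (k + 1) := (min_le_left _ _).trans (hm2 x hx)
    set q : ℕ → ℂ := fun n => p x n * starRingEnd ℂ (p y n) with hq
    have e : ∑ n ∈ I, f x n * starRingEnd ℂ (f y n) =
        ∑ n ∈ Finset.Ico (4 ^ k) b, (z x * starRingEnd ℂ (z y)) ^ n * q n := by
      have : Finset.Ico (4 ^ k) b = I.filter (· < b) := by
        rw [hI, Finset.Ico_filter_lt, min_eq_right hb2]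
      rw [this, Finset.sum_filter]
      refine Finset.sum_congr rfl fun n _ => ?_
      simp only [hf, hq, hbdef, lt_min_iff]
      by_cases h1 : n < m x <;> by_cases h2 : n < m y <;> simp [h1, h2]
      ring
    rw [e]
    have hw1 : ‖z x * starRingEnd ℂ (z y)‖ = 1 := by
      rw [norm_mul, RCLike.norm_conj, hz1, hz1, one_mul]
    have hAbel := norm_sum_pow_mul_le hw1 q (fun n => by
      rw [hq]; simp [hp1 x hx, hp1 y hy]) (4 ^ k) b hb1
    -- Each of the two phases contributes `4‖α n‖`. With the 2 from Abel summation this gives `2 +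
    -- 8(1 + 3C(k+1)) = 10 + 24C(k+1)`.
    have hV : ∑ n ∈ Finset.Ico (4 ^ k) b, ‖q (n + 1) - q n‖ ≤ 8 * (1 + 3 * (C * (k + 1))) := by
      calc ∑ n ∈ Finset.Ico (4 ^ k) b, ‖q (n + 1) - q n‖
          ≤ ∑ n ∈ Finset.Ico (4 ^ k) b, 8 * ‖α n‖ := by
            refine Finset.sum_le_sum fun n _ => ?_
            refine (norm_mul_conj_sub_mul_conj_le (hp1 y hy _) (hp1 x hx _)).trans ?_
            linarith [hp2 x hx n, hp2 y hy n]
        _ ≤ ∑ n ∈ I, 8 * ‖α n‖ := Finset.sum_le_sum_of_subset_of_nonneg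
            (Finset.Ico_subset_Ico_right hb2) fun _ _ _ => by positivity
        _ ≤ _ := by rw [← Finset.mul_sum]; gcongr
    have hsep' : (1 / 2 : ℝ) ^ k / 2 ≤ ‖z x * starRingEnd ℂ (z y) - 1‖ := by
      rw [norm_unimodular_sub_one (hz1 y)]
      refine le_trans ?_ (half_dist_le_norm_exp_sub_exp (hFa x hx) (hFa y hy))
      linarith [hsep x hx y hy hxy]
    set N := ‖∑ n ∈ Finset.Ico (4 ^ k) b, (z x * starRingEnd ℂ (z y)) ^ n * q n‖
    have hN : (1 / 2 : ℝ) ^ k / 2 * N ≤ 10 + 24 * (C * (k + 1)) := by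
      refine (mul_le_mul_of_nonneg_right hsep' (norm_nonneg _)).trans (hAbel.trans ?_)
      linarith
    calc N = 2 * 2 ^ k * ((1 / 2 : ℝ) ^ k / 2 * N) := by
          rw [one_div, inv_pow]; field_simp
      _ ≤ _ := by gcongr
  · intro x hx
    rw [hfsum x hx]
    exact (hS x hx).le

/-! ### From blocks to full sums, and the decay hypothesis -/

/-- If the sums over all pieces of the blocks `[4 ^ k, 4 ^ (k + 1))` are small, then all partial
sums are bounded. -/
theorem exists_bound_of_block_bound {E : Type*} [SeminormedAddCommGroup E] (c : ℕ → E) (e : ℕ → ℝ)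
    (he0 : ∀ k, 0 ≤ e k) (he : Summable e) (K : ℕ)
    (h : ∀ k, K ≤ k → ∀ m, 4 ^ k ≤ m → m ≤ 4 ^ (k + 1) →
      ‖∑ n ∈ Finset.Ico (4 ^ k) m, c n‖ ≤ e k) :
    ∃ M, ∀ m, ‖∑ n ∈ Finset.range m, c n‖ ≤ M := by
  set Q := ∑ n ∈ Finset.range (4 ^ K), ‖c n‖ with hQ
  have hsplit : ∀ a b, a ≤ b → ‖∑ n ∈ Finset.range b, c n‖ ≤
      ‖∑ n ∈ Finset.range a, c n‖ + ‖∑ n ∈ Finset.Ico a b, c n‖ := by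
    intro a b hab
    rw [← Finset.sum_range_add_sum_Ico _ hab]
    exact norm_add_le _ _
  have hpow : ∀ k, K ≤ k → ‖∑ n ∈ Finset.range (4 ^ k), c n‖ ≤ Q + ∑ j ∈ Finset.range k, e j := by
    intro k hk
    induction k, hk using Nat.le_induction with
    | base =>
      have := norm_sum_le (Finset.range (4 ^ K)) c
      linarith [Finset.sum_nonneg fun j (_ : j ∈ Finset.range K) => he0 j]
    | succ k hk ih =>
      have h4 : 4 ^ k ≤ 4 ^ (k + 1) := Nat.pow_le_pow_right (by norm_num) (Nat.le_succ k)
      rw [Finset.sum_range_succ]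
      linarith [hsplit _ _ h4, h k hk _ h4 le_rfl]
  refine ⟨Q + ∑' j, e j, fun m => ?_⟩
  rcases lt_or_ge m (4 ^ K) with hm | hm
  · have h1 : ∑ n ∈ Finset.range m, ‖c n‖ ≤ Q := Finset.sum_le_sum_of_subset_of_nonneg
      (Finset.range_subset_range.2 hm.le) fun _ _ _ => norm_nonneg _
    linarith [norm_sum_le (Finset.range m) c, (tsum_nonneg he0 : 0 ≤ ∑' j, e j)]
  · have hm0 : m ≠ 0 := (lt_of_lt_of_le (by positivity) hm).ne'
    have hk1 : 4 ^ Nat.log 4 m ≤ m := Nat.pow_log_le_self 4 hm0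
    have hk2 : m ≤ 4 ^ (Nat.log 4 m + 1) := (Nat.lt_pow_succ_log_self (by norm_num) m).le
    have hk : K ≤ Nat.log 4 m := Nat.le_log_of_pow_le (by norm_num) hm
    have h1 := hsplit _ _ hk1
    have h2 := he.sum_le_tsum (Finset.range (Nat.log 4 m + 1)) fun j _ => he0 j
    rw [Finset.sum_range_succ] at h2
    linarith [hpow _ hk, h _ hk m hk1 hk2]

/-- The hypothesis is applied at `N = 4^(k+1)`: the weight `n + 1` is at least `4^k` on the block,
and `log N ≤ 2(k+1)` because `log 2 < 1`. -/
theorem block_sum_sq_le (α : ℕ → ℂ) (A : ℝ) (hA : ∀ N : ℕ, 2 ≤ N →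
      ∑ n ∈ Finset.range (N + 1), ((n : ℝ) + 1) * ‖α n‖ ^ 2 ≤ A * Real.log N) (k : ℕ) :
    (∑ n ∈ Finset.Ico (4 ^ k) (4 ^ (k + 1)), ‖α n‖ ^ 2) ≤ 2 * A * (k + 1) / 4 ^ k := by
  have hA0 : 0 ≤ A := by
    have h := (Finset.sum_nonneg fun n _ => by positivity).trans (hA 2 le_rfl)
    have hl : 0 < Real.log 2 := Real.log_pos (by norm_num)
    push_cast at h
    exact nonneg_of_mul_nonneg_left h hl
  have h2 : 2 ≤ 4 ^ (k + 1) := by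
    have : 1 ≤ 4 ^ k := Nat.one_le_pow _ _ (by norm_num)
    rw [pow_succ]; omega
  have h := hA _ h2
  have hlog : Real.log ((4 ^ (k + 1) : ℕ) : ℝ) ≤ 2 * (k + 1) := by
    push_cast
    rw [Real.log_pow, show (4 : ℝ) = 2 ^ 2 by norm_num, Real.log_pow]
    push_cast
    have := Real.log_two_lt_d9
    have hk : (0 : ℝ) ≤ (k : ℝ) + 1 := by positivity
    nlinarith
  rw [le_div_iff₀ (by positivity), Finset.sum_mul]
  calc ∑ n ∈ Finset.Ico (4 ^ k) (4 ^ (k + 1)), ‖α n‖ ^ 2 * 4 ^ k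
      ≤ ∑ n ∈ Finset.Ico (4 ^ k) (4 ^ (k + 1)), (((n : ℕ) : ℝ) + 1) * ‖α n‖ ^ 2 := by
        refine Finset.sum_le_sum fun n hn => ?_
        rw [mul_comm]
        gcongr
        have : ((4 ^ k : ℕ) : ℝ) ≤ n := by exact_mod_cast (Finset.mem_Ico.1 hn).1
        push_cast at this
        linarith
    _ ≤ ∑ n ∈ Finset.range (4 ^ (k + 1) + 1), ((n : ℝ) + 1) * ‖α n‖ ^ 2 := by
        refine Finset.sum_le_sum_of_subset_of_nonneg (fun n hn => ?_)
          fun _ _ _ => by positivity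
        have := (Finset.mem_Ico.1 hn).2
        exact Finset.mem_range.2 (by omega)
    _ ≤ A * (2 * (k + 1)) := h.trans (by gcongr)
    _ = _ := by ring

theorem summable_norm_sq_of_block_bound (α : ℕ → ℂ) (C : ℝ)
    (hC : ∀ k : ℕ, (∑ n ∈ Finset.Ico (4 ^ k) (4 ^ (k + 1)), ‖α n‖ ^ 2) ≤ C * (k + 1) / 4 ^ k) :
    Summable fun n => ‖α n‖ ^ 2 := by
  have hs : Summable fun k : ℕ => C * (k + 1) / (4 : ℝ) ^ k := by
    have hr : ‖(1 / 4 : ℝ)‖ < 1 := by norm_num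
    have h1 := summable_pow_mul_geometric_of_norm_lt_one 1 hr
    have h0 := summable_geometric_of_norm_lt_one hr
    refine ((h1.add h0).mul_left C).congr fun k => ?_
    rw [one_div, inv_pow]
    field_simp
  obtain ⟨M, hM⟩ := exists_bound_of_block_bound (fun n => ‖α n‖ ^ 2) _
    (fun k => (Finset.sum_nonneg fun _ _ => by positivity).trans (hC k)) hs 0 (by
      intro k _ m _ hm2
      rw [Real.norm_of_nonneg (Finset.sum_nonneg fun _ _ => by positivity)]
      exact (Finset.sum_le_sum_of_subset_of_nonneg (Finset.Ico_subset_Ico_right hm2)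
        fun _ _ _ => by positivity).trans (hC k))
  exact summable_of_sum_range_le (fun n => by positivity)
    fun n => (le_abs_self _).trans (hM n)

/-! ### The Szegő recursion on the circle and Prüfer variables -/

theorem natDegree_reversedPoly_le (n : ℕ) (P : ℂ[X]) (hP : P.natDegree ≤ n) :
    (reversedPoly n P).natDegree ≤ n := by
  refine natDegree_le_iff_coeff_eq_zero.2 fun m hm => ?_
  rw [reversedPoly, coeff_reflect, revAt_eq_self_of_lt hm, coeff_map,
    coeff_eq_zero_of_natDegree_lt (hP.trans_lt hm), map_zero]

theorem natDegree_szegoPoly_le (a : ℕ → ℂ) (n : ℕ) : (szegoPoly a n).natDegree ≤ n := by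
  induction n with
  | zero => simp [szegoPoly]
  | succ n ih =>
    rw [szegoPoly]
    refine (natDegree_sub_le _ _).trans (max_le ?_ ?_)
    · refine natDegree_mul_le.trans ?_
      rw [natDegree_X]; omega
    · refine (natDegree_C_mul_le _ _).trans ((natDegree_reversedPoly_le n _ ih).trans ?_)
      omega

theorem eval_reversedPoly_of_norm_one {n : ℕ} {P : ℂ[X]} (hP : P.natDegree ≤ n) {z : ℂ}
    (hz : ‖z‖ = 1) : (reversedPoly n P).eval z = z ^ n * starRingEnd ℂ (P.eval z) := by
  have hz0 : z ≠ 0 := norm_ne_zero_iff.1 (by rw [hz]; norm_num)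
  have h : 1 / starRingEnd ℂ z = z := by
    rw [div_eq_iff ((_root_.map_ne_zero _).2 hz0), Complex.mul_conj', hz]; simp
  rw [eval_reversedPoly hP hz0, h]

theorem eval_szegoPoly_succ (a : ℕ → ℂ) (n : ℕ) {z : ℂ} (hz : ‖z‖ = 1) :
    (szegoPoly a (n + 1)).eval z = z * (szegoPoly a n).eval z -
      starRingEnd ℂ (a n) * (z ^ n * starRingEnd ℂ ((szegoPoly a n).eval z)) := by
  rw [szegoPoly, eval_sub, eval_mul, eval_X, eval_mul, eval_C,
    eval_reversedPoly_of_norm_one (natDegree_szegoPoly_le a n) hz]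

/-- For `‖t‖ ≤ 1/2` the numerator of the difference is at most `2‖t‖` and the denominator at least
`1/2`; otherwise the trivial bound 2 suffices. -/
theorem norm_conj_div_self_sub_one_le {t : ℂ} (ht : 1 - t ≠ 0) :
    ‖starRingEnd ℂ (1 - t) / (1 - t) - 1‖ ≤ 4 * ‖t‖ := by
  rcases le_or_gt ‖t‖ (1 / 2) with h | h
  · have h1 : 1 / 2 ≤ ‖1 - t‖ := by
      have := norm_sub_norm_le (1 : ℂ) t
      rw [norm_one] at this
      linarith
    rw [div_sub_one ht, norm_div, div_le_iff₀ (norm_pos_iff.2 ht)]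
    have h2 : ‖starRingEnd ℂ (1 - t) - (1 - t)‖ ≤ 2 * ‖t‖ := by
      rw [map_sub, map_one, sub_sub_sub_cancel_left]
      refine (norm_sub_le _ _).trans_eq ?_
      rw [RCLike.norm_conj]; ring
    nlinarith [norm_nonneg t]
  · have := norm_sub_le (starRingEnd ℂ (1 - t) / (1 - t)) 1
    rw [norm_div, RCLike.norm_conj, div_self (norm_ne_zero_iff.2 ht), norm_one] at this
    linarith

/-- The Prüfer equations for solutions of the Szegő recursion on the unit circle. -/
theorem exists_prufer_phase {z : ℂ} (hz : ‖z‖ = 1) (a f : ℕ → ℂ)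
    (hf : ∀ n, f (n + 1) = z * f n - starRingEnd ℂ (a n) * (z ^ n * starRingEnd ℂ (f n)))
    (hf0 : ∀ n, f n ≠ 0) :
    ∃ p : ℕ → ℂ, (∀ n, ‖p n‖ = 1) ∧ (∀ n, ‖p (n + 1) - p n‖ ≤ 4 * ‖a n‖) ∧
      ∀ n, ‖f (n + 1)‖ = ‖f n‖ * ‖1 - a n * (z ^ n * p n)‖ := by
  have hz0 : z ≠ 0 := norm_ne_zero_iff.1 (by rw [hz]; norm_num)
  have hzc : starRingEnd ℂ z = z⁻¹ := (Complex.inv_eq_conj hz).symm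
  -- In terms of the Prüfer angle, `p n = exp (i (η + 2 θ_n))` when `z = e^{iη}`.
  set p : ℕ → ℂ := fun n => (z⁻¹) ^ (2 * n) * z * f n / starRingEnd ℂ (f n) with hp
  have hp1 : ∀ n, ‖p n‖ = 1 := fun n => by
    have := norm_ne_zero_iff.2 (hf0 n)
    simp only [hp, norm_div, norm_mul, norm_pow, norm_inv, hz, RCLike.norm_conj]
    field_simp
    simp
  set v : ℕ → ℂ := fun n => 1 - a n * (z ^ n * p n) with hv
  have hfc : ∀ n, starRingEnd ℂ (f n) ≠ 0 := fun n => (_root_.map_ne_zero _).2 (hf0 n)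
  have hfv : ∀ n, f (n + 1) = z * f n * starRingEnd ℂ (v n) := by
    intro n
    have h0 := hf0 n
    have h1 := hfc n
    simp only [hf, hv, hp, map_sub, map_one, map_mul, map_pow, map_div₀, map_inv₀, hzc, inv_inv,
      Complex.conj_conj, inv_pow]
    field_simp
    ring
  have hv0 : ∀ n, v n ≠ 0 := fun n h => hf0 (n + 1) (by rw [hfv, h]; simp)
  have hpv : ∀ n, p (n + 1) = p n * (starRingEnd ℂ (v n) / v n) := by
    intro n
    have h0 := hf0 n
    have h1 := hfc n
    have h2 := hv0 n
    simp only [hp, hfv, map_mul, Complex.conj_conj, hzc, inv_pow]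
    field_simp
    ring
  refine ⟨p, hp1, fun n => ?_, fun n => ?_⟩
  · have : p (n + 1) - p n = p n * (starRingEnd ℂ (v n) / v n - 1) := by rw [hpv]; ring
    rw [this, norm_mul, hp1, one_mul]
    refine (norm_conj_div_self_sub_one_le (hv0 n)).trans_eq ?_
    rw [norm_mul, norm_mul, norm_pow, hz, hp1]; simp
  · rw [hfv, norm_mul, norm_mul, hz, RCLike.norm_conj, one_mul]

/-- Expanding the square and using `1 + y ≤ e^y` leaves a linear term, handled by the block sums,
and a square-summable remainder. -/
theorem norm_one_sub_sq_le (t : ℂ) : ‖1 - t‖ ^ 2 ≤ Real.exp (2 * ‖t‖ ^ 2 - 2 * t.re) := by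
  have h : ‖1 - t‖ ^ 2 = 1 - 2 * t.re + ‖t‖ ^ 2 := by
    rw [← Complex.normSq_eq_norm_sq, ← Complex.normSq_eq_norm_sq, Complex.normSq_apply,
      Complex.normSq_apply, Complex.sub_re, Complex.sub_im, Complex.one_re, Complex.one_im]
    ring
  rw [h]
  have := Real.add_one_le_exp (2 * ‖t‖ ^ 2 - 2 * t.re)
  nlinarith [sq_nonneg ‖t‖]

theorem norm_sq_le_exp_of_norm_succ (f t : ℕ → ℂ) (h : ∀ n, ‖f (n + 1)‖ = ‖f n‖ * ‖1 - t n‖)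
    (n : ℕ) : ‖f n‖ ^ 2 ≤ ‖f 0‖ ^ 2 * Real.exp (2 * ∑ j ∈ Finset.range n, ‖t j‖ ^ 2 -
      2 * (∑ j ∈ Finset.range n, t j).re) := by
  induction n with
  | zero => simp
  | succ n ih =>
    rw [h, mul_pow, Finset.sum_range_succ, Finset.sum_range_succ, Complex.add_re]
    calc _ ≤ (‖f 0‖ ^ 2 * Real.exp (2 * ∑ j ∈ Finset.range n, ‖t j‖ ^ 2 -
          2 * (∑ j ∈ Finset.range n, t j).re)) * Real.exp (2 * ‖t n‖ ^ 2 - 2 * (t n).re) := by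
          gcongr
          exact norm_one_sub_sq_le _
      _ = _ := by
          rw [mul_assoc, ← Real.exp_add]
          ring_nf

/-- A Prüfer radius is bounded away from the points with infinitely many large block sums. -/
theorem bddAbove_pruferRadius (α : ℕ → ℂ) (hα : Summable fun n => ‖α n‖ ^ 2) {a η β : ℝ}
    (hη : η ∈ Set.Icc a (a + Real.pi)) (hB : ¬ ∃ᶠ k in Filter.atTop, η ∈ largeSumSet α a k) :
    BddAbove (Set.range fun n => pruferRadius α n η β) := by
  set z : ℂ := Complex.exp (Complex.I * η) with hz
  have hz1 : ‖z‖ = 1 := by rw [hz, mul_comm]; exact Complex.norm_exp_ofReal_mul_I η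
  set ω : ℂ := Complex.exp (Complex.I * β) with hω
  have hω1 : ‖ω‖ = 1 := by rw [hω, mul_comm]; exact Complex.norm_exp_ofReal_mul_I β
  set f : ℕ → ℂ := fun n => (rotatedPoly α β n).eval z with hf
  have hrec := fun n => eval_szegoPoly_succ (fun n => ω * α n) n hz1
  change BddAbove (Set.range fun n => ‖f n‖)
  by_cases hf0 : ∀ n, f n ≠ 0
  · obtain ⟨p, hp1, hp2, hp3⟩ := exists_prufer_phase hz1 _ f hrec hf0
    rw [Filter.not_frequently] at hB
    obtain ⟨K, hK⟩ := Filter.eventually_atTop.1 hB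
    obtain ⟨M, hM⟩ := exists_bound_of_block_bound (fun n => α n * (z ^ n * (ω * p n)))
      (fun k : ℕ => 1 / ((k : ℝ) + 1) ^ 2) (fun k => by positivity)
      (by
        have := (summable_nat_add_iff (f := fun k : ℕ => 1 / (k : ℝ) ^ 2) 1).2
          (Real.summable_one_div_nat_pow.2 one_lt_two)
        simpa using this) K (by
        intro k hk m hm1 hm2
        by_contra hcon
        -- The rotated phases `ω * p n` obey the same bounds, so `largeSumSet` need not depend on
        -- `β`.
        refine hK k hk ⟨hη, fun n => ω * p n, fun n => ?_, fun n => ?_, m, hm1, hm2, ?_⟩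
        · rw [norm_mul, hω1, hp1, one_mul]
        · rw [← mul_sub, norm_mul, hω1, one_mul]
          refine (hp2 n).trans_eq ?_
          rw [norm_mul, hω1, one_mul]
        · exact not_le.1 hcon)
    refine ⟨1 + Real.exp (2 * ∑' n, ‖α n‖ ^ 2 + 2 * M), ?_⟩
    rintro _ ⟨n, rfl⟩
    have h1 := norm_sq_le_exp_of_norm_succ f (fun n => α n * (z ^ n * (ω * p n)))
      (fun n => by rw [hp3]; congr 2; ring) n
    have h2 : ‖f 0‖ = 1 := by simp [hf, rotatedPoly, szegoPoly]
    have h3 : ∀ j, ‖α j * (z ^ j * (ω * p j))‖ = ‖α j‖ := fun j => by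
      simp [hz1, hω1, hp1]
    simp only [h3, h2, one_pow, one_mul] at h1
    have h4 := hα.sum_le_tsum (Finset.range n) fun j _ => by positivity
    have h5 := (abs_le.1 ((Complex.abs_re_le_norm _).trans (hM n))).1
    have h6 := h1.trans (Real.exp_le_exp.2
      (show _ ≤ 2 * ∑' n, ‖α n‖ ^ 2 + 2 * M by linarith))
    simp only
    nlinarith [norm_nonneg (f n)]
  -- No bound on `|α n|` is available here, so `f` may vanish; the recursion then keeps it zero
  -- forever.
  · push Not at hf0
    obtain ⟨N, hN⟩ := hf0
    have hz : ∀ n, N ≤ n → f n = 0 := by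
      intro n hn
      induction n, hn using Nat.le_induction with
      | base => exact hN
      | succ n _ ih =>
        have := hrec n
        change f (n + 1) = z * f n - _ * (_ * starRingEnd ℂ (f n)) at this
        rw [this, ih]; simp
    refine ⟨∑ j ∈ Finset.range N, ‖f j‖, ?_⟩
    rintro _ ⟨n, rfl⟩
    rcases lt_or_ge n N with h | h
    · exact Finset.single_le_sum (f := fun j => ‖f j‖) (fun j _ => norm_nonneg _)
        (Finset.mem_range.2 h)
    · simp only [hz n h, norm_zero]
      exact Finset.sum_nonneg fun _ _ => norm_nonneg _

theorem dimH_unboundedSet_eq_zero (α : ℕ → ℂ) (C : ℝ)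
    (hC : ∀ k : ℕ, (∑ n ∈ Finset.Ico (4 ^ k) (4 ^ (k + 1)), ‖α n‖ ^ 2) ≤ C * (k + 1) / 4 ^ k) :
    dimH (unboundedSet α) = 0 := by
  have hdim : ∀ a, dimH {η | ∃ᶠ k in Filter.atTop, η ∈ largeSumSet α a k} = 0 := fun a =>
    dimH_frequently_mem_eq_zero _ (card_ne_of_separated_largeSumSet α a C hC)
  have hsub : unboundedSet α ⊆ {η | ∃ᶠ k in Filter.atTop, η ∈ largeSumSet α 0 k} ∪
      {η | ∃ᶠ k in Filter.atTop, η ∈ largeSumSet α Real.pi k} := by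
    rintro η ⟨hη, β, -, hβ⟩
    by_contra hcon
    rw [Set.mem_union, not_or] at hcon
    have hs := summable_norm_sq_of_block_bound α C hC
    rcases le_total η Real.pi with h | h
    · exact hβ (bddAbove_pruferRadius α hs ⟨hη.1, by linarith⟩ hcon.1)
    · exact hβ (bddAbove_pruferRadius α hs ⟨h, by linarith [hη.2]⟩ hcon.2)
  refine le_antisymm ((dimH_mono hsub).trans ?_) zero_le
  rw [dimH_union, hdim, hdim, max_self]

/-! ### Orthogonality in `L²(μ)` -/

theorem norm_toCircle {T : ℝ} (x : AddCircle T) : ‖(AddCircle.toCircle x : ℂ)‖ = 1 :=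
  Circle.norm_coe _

theorem continuous_eval_toCircle {T : ℝ} (P : ℂ[X]) :
    Continuous fun x : AddCircle T => P.eval (AddCircle.toCircle x : ℂ) :=
  P.continuous.comp (continuous_subtype_val.comp AddCircle.continuous_toCircle)

theorem integrable_of_continuous_addCircle {E : Type*} [NormedAddCommGroup E]
    {T : ℝ} [Fact (0 < T)] (μ : Measure (AddCircle T)) [IsFiniteMeasure μ] {f : AddCircle T → E}
    (hf : Continuous f) : Integrable f μ :=
  hf.integrable_of_hasCompactSupport (HasCompactSupport.of_compactSpace f)

/-- Termwise `log (1 - x) ≥ -x / (1 - x)`, and the right side is summable since `x n` is eventually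
below `1/2`. Strictness for every `n` rules out a zero factor. -/
theorem prod_one_sub_ge {x : ℕ → ℝ} (h0 : ∀ n, 0 ≤ x n) (h1 : ∀ n, x n < 1) (hs : Summable x) :
    ∃ c, 0 < c ∧ ∀ n, c ≤ ∏ j ∈ Finset.range n, (1 - x j) := by
  have hs' : Summable fun n => x n / (1 - x n) := by
    refine Summable.of_norm_bounded_eventually_nat (g := fun n => 2 * x n) (hs.mul_left 2) ?_
    filter_upwards [hs.tendsto_atTop_zero.eventually (gt_mem_nhds (show (0 : ℝ) < 1 / 2 by norm_num))]
      with n hn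
    have : 0 < 1 - x n := by linarith
    rw [Real.norm_of_nonneg (div_nonneg (h0 n) this.le), div_le_iff₀ this]
    nlinarith [h0 n]
  refine ⟨Real.exp (-∑' n, x n / (1 - x n)), Real.exp_pos _, fun n => ?_⟩
  have hle := hs'.sum_le_tsum (Finset.range n)
    fun j _ => div_nonneg (h0 j) (by linarith [h1 j])
  refine (Real.exp_le_exp.2 (neg_le_neg hle)).trans ?_
  rw [← Finset.sum_neg_distrib, Real.exp_sum]
  refine Finset.prod_le_prod (fun _ _ => (Real.exp_pos _).le) fun j _ => ?_
  have hp : 0 < 1 - x j := by linarith [h1 j]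
  rw [← Real.le_log_iff_exp_le hp]
  refine le_trans (le_of_eq ?_) (Real.one_sub_inv_le_log_of_pos hp)
  field_simp
  ring

namespace IsMonicOrthogonal

variable {μ : Measure (AddCircle (2 * Real.pi))} {Φ : ℕ → ℂ[X]}

/-- Subtracting the multiple of `Φ d` that cancels the coefficient of degree `d` lowers the degree
bound. -/
theorem integral_conj_mul_eq_zero_of_degree_lt [IsFiniteMeasure μ] (h : IsMonicOrthogonal μ Φ)
    (n : ℕ) (d : ℕ) (hd : d ≤ n) (Q : ℂ[X]) (hQ : Q.degree < d) :
    ∫ η, starRingEnd ℂ (Q.eval (AddCircle.toCircle η : ℂ)) *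
        (Φ n).eval (AddCircle.toCircle η : ℂ) ∂μ = 0 := by
  induction d generalizing Q with
  | zero =>
    have : Q = 0 := by
      rw [← degree_eq_bot]
      exact Nat.WithBot.lt_zero_iff.1 (by exact_mod_cast hQ)
    simp [this]
  | succ d ih =>
    have hint : ∀ P Q : ℂ[X], Integrable (fun η : AddCircle (2 * Real.pi) =>
        starRingEnd ℂ (P.eval (AddCircle.toCircle η : ℂ)) *
          Q.eval (AddCircle.toCircle η : ℂ)) μ := fun P Q => integrable_of_continuous_addCircle μ
      ((Complex.continuous_conj.comp (continuous_eval_toCircle P)).mul (continuous_eval_toCircle Q))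
    set R := Q - C (Q.coeff d) * Φ d with hR
    have hRd : R.degree < d := by
      rw [degree_lt_iff_coeff_zero]
      intro m hm
      rw [hR, coeff_sub, coeff_C_mul]
      rcases hm.eq_or_lt with rfl | hm
      · have := (h.1 d).1.coeff_natDegree
        rw [(h.1 d).2] at this
        rw [this, mul_one, sub_self]
      · have h1 : (Φ d).coeff m = 0 :=
          coeff_eq_zero_of_natDegree_lt (by rw [(h.1 d).2]; exact hm)
        rw [h1, (degree_lt_iff_coeff_zero _ _).1 hQ m hm, mul_zero, sub_zero]
    have hQR : Q = R + C (Q.coeff d) * Φ d := by rw [hR]; ring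
    have e : ∀ η : AddCircle (2 * Real.pi), starRingEnd ℂ (Q.eval (AddCircle.toCircle η : ℂ)) *
        (Φ n).eval (AddCircle.toCircle η : ℂ) =
        starRingEnd ℂ (R.eval (AddCircle.toCircle η : ℂ)) * (Φ n).eval (AddCircle.toCircle η : ℂ) +
        starRingEnd ℂ (Q.coeff d) * (starRingEnd ℂ ((Φ d).eval (AddCircle.toCircle η : ℂ)) *
          (Φ n).eval (AddCircle.toCircle η : ℂ)) := by
      intro η
      conv_lhs => rw [hQR]
      rw [eval_add, eval_mul, eval_C, map_add, map_mul]
      ring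
    simp_rw [e]
    rw [integral_add (hint _ _) ((hint _ _).const_mul _), ih (by omega) R hRd,
      integral_const_mul, h.2 d n (by omega), mul_zero, add_zero]

theorem eq_szegoPoly (h : IsMonicOrthogonal μ Φ) {α : ℕ → ℂ}
    (hrec : ∀ n, Φ (n + 1) = X * Φ n - C (starRingEnd ℂ (α n)) * reversedPoly n (Φ n)) :
    Φ = szegoPoly α := by
  funext n
  induction n with
  | zero => exact eq_one_of_monic_natDegree_zero (h.1 0).1 (h.1 0).2
  | succ n ih => rw [hrec, ih, szegoPoly]

/-- Pythagoras for `z Φ_n = Φ_{n+1} + conj(α_n) Φ_n^*`: the reversed polynomial has degree at most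
`n`, so it is orthogonal to `Φ_{n+1}`, and `|Φ_n^*| = |Φ_n|` on the circle. -/
theorem integral_norm_sq_succ [IsFiniteMeasure μ] {α : ℕ → ℂ}
    (h : IsMonicOrthogonal μ (szegoPoly α)) (n : ℕ) :
    ∫ η, ‖(szegoPoly α (n + 1)).eval (AddCircle.toCircle η : ℂ)‖ ^ 2 ∂μ =
      (1 - ‖α n‖ ^ 2) * ∫ η, ‖(szegoPoly α n).eval (AddCircle.toCircle η : ℂ)‖ ^ 2 ∂μ := by
  set Φ := szegoPoly α with hΦ
  have hcont := fun P : ℂ[X] => continuous_eval_toCircle (T := 2 * Real.pi) P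
  have hdeg : (reversedPoly n (Φ n)).degree < ((n + 1 : ℕ) : WithBot ℕ) :=
    lt_of_le_of_lt (degree_le_of_natDegree_le
      (natDegree_reversedPoly_le n _ (natDegree_szegoPoly_le α n)))
      (by exact_mod_cast Nat.lt_succ_self n)
  have horth := h.integral_conj_mul_eq_zero_of_degree_lt (n + 1) (n + 1) le_rfl _ hdeg
  have hint : Integrable (fun η : AddCircle (2 * Real.pi) =>
      α n * (starRingEnd ℂ ((reversedPoly n (Φ n)).eval (AddCircle.toCircle η : ℂ)) *
        (Φ (n + 1)).eval (AddCircle.toCircle η : ℂ))) μ :=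
    integrable_of_continuous_addCircle μ (continuous_const.mul
      ((Complex.continuous_conj.comp (hcont _)).mul (hcont _)))
  have hre : ∫ η, (α n * (starRingEnd ℂ ((reversedPoly n (Φ n)).eval
      (AddCircle.toCircle η : ℂ)) * (Φ (n + 1)).eval (AddCircle.toCircle η : ℂ))).re ∂μ = 0 := by
    have := integral_re hint
    simp only [RCLike.re_to_complex] at this
    rw [this, integral_const_mul, horth, mul_zero, Complex.zero_re]
  have hpt : ∀ η : AddCircle (2 * Real.pi),
      ‖(Φ (n + 1)).eval (AddCircle.toCircle η : ℂ)‖ ^ 2 =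
      (1 - ‖α n‖ ^ 2) * ‖(Φ n).eval (AddCircle.toCircle η : ℂ)‖ ^ 2 - 2 *
      (α n * (starRingEnd ℂ ((reversedPoly n (Φ n)).eval (AddCircle.toCircle η : ℂ)) *
        (Φ (n + 1)).eval (AddCircle.toCircle η : ℂ))).re := by
    intro η
    have hz := norm_toCircle η
    have hs := eval_szegoPoly_succ α n hz
    rw [← eval_reversedPoly_of_norm_one (natDegree_szegoPoly_le α n) hz, ← hΦ] at hs
    have hrn : ‖(reversedPoly n (Φ n)).eval (AddCircle.toCircle η : ℂ)‖ =
        ‖(Φ n).eval (AddCircle.toCircle η : ℂ)‖ := by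
      rw [eval_reversedPoly_of_norm_one (natDegree_szegoPoly_le α n) hz, norm_mul, norm_pow, hz,
        one_pow, one_mul, RCLike.norm_conj]
    have hzn : ‖(AddCircle.toCircle η : ℂ) * (Φ n).eval (AddCircle.toCircle η : ℂ)‖ =
        ‖(Φ n).eval (AddCircle.toCircle η : ℂ)‖ := by rw [norm_mul, hz, one_mul]
    set u := (Φ (n + 1)).eval (AddCircle.toCircle η : ℂ)
    set v := (reversedPoly n (Φ n)).eval (AddCircle.toCircle η : ℂ)
    have h1 : (AddCircle.toCircle η : ℂ) * (Φ n).eval (AddCircle.toCircle η : ℂ) =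
        u + starRingEnd ℂ (α n) * v := by rw [hs]; ring
    rw [h1] at hzn
    have h2 : ‖u + starRingEnd ℂ (α n) * v‖ ^ 2 =
        ‖u‖ ^ 2 + ‖α n‖ ^ 2 * ‖v‖ ^ 2 + 2 * (α n * (starRingEnd ℂ v * u)).re := by
      rw [← Complex.normSq_eq_norm_sq, Complex.normSq_add, Complex.normSq_eq_norm_sq,
        Complex.normSq_eq_norm_sq, norm_mul, RCLike.norm_conj, map_mul, Complex.conj_conj, mul_pow,
        mul_comm u, mul_assoc]
    rw [hzn, hrn] at h2
    linarith
  simp_rw [hpt]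
  rw [integral_sub, integral_const_mul, integral_const_mul, hre, mul_zero, sub_zero]
  · exact (integrable_of_continuous_addCircle μ ((hcont _).norm.pow 2)).const_mul _
  · exact hint.re.const_mul 2

theorem integral_norm_sq_pos [IsFiniteMeasure μ] (h : IsMonicOrthogonal μ Φ)
    (hμ : ∀ F : Set (AddCircle (2 * Real.pi)), F.Finite → μ Fᶜ ≠ 0) (n : ℕ) :
    0 < ∫ η, ‖(Φ n).eval (AddCircle.toCircle η : ℂ)‖ ^ 2 ∂μ := by
  refine lt_of_le_of_ne (integral_nonneg fun _ => by positivity) fun h0 => ?_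
  have hfin : {η : AddCircle (2 * Real.pi) |
      (Φ n).eval (AddCircle.toCircle η : ℂ) = 0}.Finite := by
    have hinj : Function.Injective fun η : AddCircle (2 * Real.pi) =>
        (AddCircle.toCircle η : ℂ) :=
      Subtype.val_injective.comp (AddCircle.injective_toCircle Real.two_pi_pos.ne')
    refine ((Φ n).rootSet_finite ℂ |>.preimage hinj.injOn).subset fun η hη => ?_
    rw [Set.mem_preimage, mem_rootSet]
    exact ⟨(h.1 n).1.ne_zero, by simpa using hη⟩
  refine hμ _ hfin ?_
  have hint : Integrable (fun η : AddCircle (2 * Real.pi) =>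
      ‖(Φ n).eval (AddCircle.toCircle η : ℂ)‖ ^ 2) μ :=
    integrable_of_continuous_addCircle μ ((continuous_eval_toCircle _).norm.pow 2)
  have hae := (integral_eq_zero_iff_of_nonneg (fun _ => by positivity) hint).1 h0.symm
  refine measure_mono_null (fun η hη => ?_) (ae_iff.1 hae)
  simpa using hη

theorem norm_verblunsky_lt_one [IsFiniteMeasure μ] {α : ℕ → ℂ}
    (h : IsMonicOrthogonal μ (szegoPoly α))
    (hμ : ∀ F : Set (AddCircle (2 * Real.pi)), F.Finite → μ Fᶜ ≠ 0) (n : ℕ) : ‖α n‖ ^ 2 < 1 := by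
  have h1 := h.integral_norm_sq_pos hμ (n + 1)
  rw [h.integral_norm_sq_succ] at h1
  linarith [pos_of_mul_pos_left h1 (h.integral_norm_sq_pos hμ n).le]

theorem integral_norm_sq_le_one [IsProbabilityMeasure μ] {α : ℕ → ℂ}
    (h : IsMonicOrthogonal μ (szegoPoly α)) (n : ℕ) :
    ∫ η, ‖(szegoPoly α n).eval (AddCircle.toCircle η : ℂ)‖ ^ 2 ∂μ ≤ 1 := by
  induction n with
  | zero => simp [szegoPoly]
  | succ n ih =>
    rw [h.integral_norm_sq_succ]
    have : 0 ≤ ∫ η, ‖(szegoPoly α n).eval (AddCircle.toCircle η : ℂ)‖ ^ 2 ∂μ :=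
      integral_nonneg fun _ => by positivity
    nlinarith [sq_nonneg ‖α n‖]

/-- The cross terms vanish by orthogonality, and each monic polynomial has `L²` norm at most 1. -/
theorem integral_norm_sq_sum_le [IsProbabilityMeasure μ] {α : ℕ → ℂ}
    (h : IsMonicOrthogonal μ (szegoPoly α)) (c : ℕ → ℂ) (n : ℕ) :
    ∫ η, ‖∑ j ∈ Finset.range n, c j * (szegoPoly α j).eval (AddCircle.toCircle η : ℂ)‖ ^ 2 ∂μ ≤
      ∑ j ∈ Finset.range n, ‖c j‖ ^ 2 := by
  have hcont := fun P : ℂ[X] => continuous_eval_toCircle (T := 2 * Real.pi) P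
  induction n with
  | zero => simp
  | succ n ih =>
    set S : ℂ[X] := ∑ j ∈ Finset.range n, C (c j) * szegoPoly α j with hS
    have hSe : ∀ z, S.eval z = ∑ j ∈ Finset.range n, c j * (szegoPoly α j).eval z := fun z => by
      simp [hS, eval_finsetSum]
    have hdeg : S.degree < (n : WithBot ℕ) := by
      refine (degree_lt_iff_coeff_zero _ _).2 fun m hm => ?_
      rw [hS, finsetSum_coeff]
      refine Finset.sum_eq_zero fun j hj => ?_
      rw [coeff_C_mul, coeff_eq_zero_of_natDegree_lt, mul_zero]
      exact lt_of_le_of_lt (natDegree_szegoPoly_le α j)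
        ((Finset.mem_range.1 hj).trans_le hm)
    have horth := h.integral_conj_mul_eq_zero_of_degree_lt n n le_rfl S hdeg
    have hint : Integrable (fun η : AddCircle (2 * Real.pi) =>
        c n * (starRingEnd ℂ (S.eval (AddCircle.toCircle η : ℂ)) *
          (szegoPoly α n).eval (AddCircle.toCircle η : ℂ))) μ :=
      integrable_of_continuous_addCircle μ (continuous_const.mul
        ((Complex.continuous_conj.comp (hcont _)).mul (hcont _)))
    have hre : ∫ η, (c n * (starRingEnd ℂ (S.eval (AddCircle.toCircle η : ℂ)) *
        (szegoPoly α n).eval (AddCircle.toCircle η : ℂ))).re ∂μ = 0 := by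
      have := integral_re hint
      simp only [RCLike.re_to_complex] at this
      rw [this, integral_const_mul, horth, mul_zero, Complex.zero_re]
    have hpt : ∀ η : AddCircle (2 * Real.pi),
        ‖∑ j ∈ Finset.range (n + 1), c j * (szegoPoly α j).eval (AddCircle.toCircle η : ℂ)‖ ^ 2 =
        (‖S.eval (AddCircle.toCircle η : ℂ)‖ ^ 2 +
          ‖c n‖ ^ 2 * ‖(szegoPoly α n).eval (AddCircle.toCircle η : ℂ)‖ ^ 2) +
        2 * (c n * (starRingEnd ℂ (S.eval (AddCircle.toCircle η : ℂ)) *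
          (szegoPoly α n).eval (AddCircle.toCircle η : ℂ))).re := by
      intro η
      rw [Finset.sum_range_succ, ← hSe, add_comm (S.eval _), ← Complex.normSq_eq_norm_sq,
        Complex.normSq_add, Complex.normSq_eq_norm_sq, Complex.normSq_eq_norm_sq, norm_mul, mul_pow,
        mul_comm (starRingEnd ℂ _) (eval _ (szegoPoly α n)), ← mul_assoc]
      ring
    simp_rw [hpt, hSe]
    simp_rw [hSe] at hre hint
    have i1 : Integrable (fun η : AddCircle (2 * Real.pi) =>
        ‖∑ j ∈ Finset.range n, c j * (szegoPoly α j).eval (AddCircle.toCircle η : ℂ)‖ ^ 2) μ :=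
      integrable_of_continuous_addCircle μ ((continuous_finsetSum _ fun j _ =>
        continuous_const.mul (hcont _)).norm.pow 2)
    have i2 : Integrable (fun η : AddCircle (2 * Real.pi) =>
        ‖c n‖ ^ 2 * ‖(szegoPoly α n).eval (AddCircle.toCircle η : ℂ)‖ ^ 2) μ :=
      integrable_of_continuous_addCircle μ (continuous_const.mul ((hcont _).norm.pow 2))
    have i3 : Integrable (fun η : AddCircle (2 * Real.pi) => 2 * (c n * (starRingEnd ℂ
        (∑ j ∈ Finset.range n, c j * (szegoPoly α j).eval (AddCircle.toCircle η : ℂ)) *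
          (szegoPoly α n).eval (AddCircle.toCircle η : ℂ))).re) μ := hint.re.const_mul 2
    have i12 : Integrable (fun η : AddCircle (2 * Real.pi) =>
        ‖∑ j ∈ Finset.range n, c j * (szegoPoly α j).eval (AddCircle.toCircle η : ℂ)‖ ^ 2 +
        ‖c n‖ ^ 2 * ‖(szegoPoly α n).eval (AddCircle.toCircle η : ℂ)‖ ^ 2) μ := i1.add i2
    rw [integral_add i12 i3, integral_add i1 i2,
      integral_const_mul, integral_const_mul, hre, mul_zero, add_zero, Finset.sum_range_succ]
    have := mul_le_mul_of_nonneg_left (h.integral_norm_sq_le_one n) (sq_nonneg ‖c n‖)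
    linarith

end IsMonicOrthogonal

/-! ### Wronskians and nearby spectral parameters -/

/-- Solutions of the Szegő recursion with coefficients `a`, written as a first order system. -/
structure IsSzegoSolution (a : ℕ → ℂ) (z : ℂ) (f f' : ℕ → ℂ) : Prop where
  succ : ∀ n, f (n + 1) = z * f n - starRingEnd ℂ (a n) * f' n
  succ' : ∀ n, f' (n + 1) = f' n - a n * z * f n

namespace IsSzegoSolution

variable {a : ℕ → ℂ} {z ζ : ℂ} {f f' g g' h h' : ℕ → ℂ}

theorem of_szegoPoly (a : ℕ → ℂ) (hz : ‖z‖ = 1) :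
    IsSzegoSolution a z (fun n => (szegoPoly a n).eval z)
      fun n => z ^ n * starRingEnd ℂ ((szegoPoly a n).eval z) := by
  have hz0 : z ≠ 0 := norm_ne_zero_iff.1 (by rw [hz]; norm_num)
  refine ⟨fun n => eval_szegoPoly_succ a n hz, fun n => ?_⟩
  have hzc : starRingEnd ℂ z = z⁻¹ := (Complex.inv_eq_conj hz).symm
  simp only [eval_szegoPoly_succ a n hz, map_sub, map_mul, Complex.conj_conj, map_pow, hzc, inv_pow]
  field_simp
  ring

/-- The polynomials of the second kind solve the same system once the reversed component changes
sign, which supplies a second independent solution. -/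
theorem of_szegoPoly_neg (a : ℕ → ℂ) (hz : ‖z‖ = 1) :
    IsSzegoSolution a z (fun n => (szegoPoly (-a) n).eval z)
      fun n => -(z ^ n * starRingEnd ℂ ((szegoPoly (-a) n).eval z)) := by
  obtain ⟨h1, h2⟩ := of_szegoPoly (-a) hz
  refine ⟨fun n => (h1 n).trans ?_, fun n => neg_eq_iff_eq_neg.2 ((h2 n).trans ?_)⟩
  · simp
  · simp; ring

/-- Different parameters `z` and `ζ` are allowed because variation of constants compares solutions
at two points. -/
theorem wronskian_succ (hf : IsSzegoSolution a z f f') (hg : IsSzegoSolution a ζ g g') (n : ℕ) :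
    f (n + 1) * g' (n + 1) - g (n + 1) * f' (n + 1) =
      (1 - starRingEnd ℂ (a n) * a n) * (z * f n * g' n - ζ * g n * f' n) := by
  rw [hf.succ, hf.succ', hg.succ, hg.succ']
  ring

theorem wronskian_eq (hf : IsSzegoSolution a z f f') (hg : IsSzegoSolution a z g g') (n : ℕ) :
    f n * g' n - g n * f' n = z ^ n * (∏ j ∈ Finset.range n, (1 - ‖a j‖ ^ 2) : ℝ) *
      (f 0 * g' 0 - g 0 * f' 0) := by
  induction n with
  | zero => simp
  | succ n ih =>
    have h1 : starRingEnd ℂ (a n) * a n = (‖a n‖ ^ 2 : ℝ) := by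
      rw [Complex.conj_mul']; push_cast; rfl
    have h2 : z * f n * g' n - z * g n * f' n = z * (f n * g' n - g n * f' n) := by ring
    rw [wronskian_succ hf hg, h2, ih, h1, Finset.prod_range_succ]
    push_cast
    ring

/-- Two bounded solutions with a Wronskian bounded away from zero control the solutions at nearby
points. -/
theorem norm_sub_le_of_nearby (hζ : ‖ζ‖ = 1) {M c : ℝ} (hc : 0 < c) (hM : 0 ≤ M)
    (hf : IsSzegoSolution a ζ f f') (hg : IsSzegoSolution a ζ g g')
    (hh : IsSzegoSolution a z h h') (h0 : h 0 = f 0) (h0' : h' 0 = f' 0)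
    (ha : ∀ n, ‖a n‖ ^ 2 < 1)
    (hfM : ∀ n, ‖f n‖ ≤ M) (hfM' : ∀ n, ‖f' n‖ ≤ M) (hgM : ∀ n, ‖g n‖ ≤ M)
    (hgM' : ∀ n, ‖g' n‖ ≤ M) (hW : ∀ n, 2 * c ≤ ‖f n * g' n - g n * f' n‖) (n : ℕ)
    (hn : n * (‖z - ζ‖ * (M ^ 2 / c)) ≤ 1) :
    ‖h n - f n‖ ≤ M * (2 * (n * (‖z - ζ‖ * (M ^ 2 / c)))) := by
  set W : ℕ → ℂ := fun n => f n * g' n - g n * f' n with hWdef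
  have hW0 : ∀ n, W n ≠ 0 := fun n => norm_pos_iff.1 (lt_of_lt_of_le (by positivity) (hW n))
  have hζ0 : ζ ≠ 0 := norm_ne_zero_iff.1 (by rw [hζ]; norm_num)
  -- Cramer's rule for writing `(h, h')` in the basis `(f, f')`, `(g, g')`. The coefficients change
  -- only through `z - ζ`.
  set A : ℕ → ℂ := fun n => (h n * g' n - g n * h' n) / W n with hA
  set B : ℕ → ℂ := fun n => -(h n * f' n - f n * h' n) / W n with hB
  have hAB : ∀ n, h n = A n * f n + B n * g n := by
    intro n
    have := hW0 n
    simp only [hA, hB, div_mul_eq_mul_div, ← add_div]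
    rw [eq_div_iff this]
    simp only [hWdef]
    ring
  have hρ : ∀ n, (1 - starRingEnd ℂ (a n) * a n) ≠ 0 := by
    intro n
    rw [Complex.conj_mul', ← Complex.ofReal_one, ← Complex.ofReal_pow, ← Complex.ofReal_sub,
      Complex.ofReal_ne_zero]
    linarith [ha n]
  have hWs : ∀ n, W (n + 1) = (1 - starRingEnd ℂ (a n) * a n) * (ζ * W n) := fun n =>
    (wronskian_succ hf hg n).trans (by simp only [hWdef]; ring)
  have hAs : ∀ n, A (n + 1) - A n = (z - ζ) * h n * g' n / (ζ * W n) := by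
    intro n
    have h1 := hW0 n
    have h2 := hρ n
    simp only [hA, wronskian_succ hh hg, hWs]
    rw [mul_div_mul_left _ _ h2]
    field_simp
    ring
  have hBs : ∀ n, B (n + 1) - B n = -((z - ζ) * h n * f' n / (ζ * W n)) := by
    intro n
    have h1 := hW0 n
    have h2 := hρ n
    simp only [hB, wronskian_succ hh hf, hWs]
    rw [← mul_neg, mul_div_mul_left _ _ h2]
    field_simp
    ring
  set D := ‖z - ζ‖ * (M ^ 2 / c) with hD
  have hD0 : 0 ≤ D := by positivity
  set E : ℕ → ℝ := fun n => ‖A n - 1‖ + ‖B n‖ with hE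
  have hhE : ∀ n, ‖h n‖ ≤ M * (1 + E n) := by
    intro n
    have h1 : ‖A n‖ ≤ 1 + ‖A n - 1‖ := by
      have := norm_add_le (1 : ℂ) (A n - 1)
      rwa [norm_one, add_sub_cancel] at this
    rw [hAB]
    refine (norm_add_le _ _).trans ?_
    rw [norm_mul, norm_mul]
    have h2 := mul_le_mul h1 (hfM n) (norm_nonneg _) (by positivity)
    have h3 := mul_le_mul_of_nonneg_left (hgM n) (norm_nonneg (B n))
    simp only [hE]
    linarith
  have hstep : ∀ n (w : ℂ), ‖w‖ ≤ M →
      ‖(z - ζ) * h n * w / (ζ * W n)‖ ≤ D / 2 * (1 + E n) := by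
    intro n w hw
    have hE0 : 0 ≤ E n := by positivity
    rw [norm_div, norm_mul, norm_mul, norm_mul, hζ, one_mul]
    calc ‖z - ζ‖ * ‖h n‖ * ‖w‖ / ‖W n‖ ≤ ‖z - ζ‖ * (M * (1 + E n)) * M / (2 * c) := by
          gcongr
          · exact hhE n
          · exact hW n
      _ = D / 2 * (1 + E n) := by rw [hD]; field_simp
  have hEs : ∀ n, 1 + E (n + 1) ≤ (1 + D) * (1 + E n) := by
    intro n
    have h1 := hstep n _ (hgM' n)
    have h2 := hstep n _ (hfM' n)
    rw [← hAs] at h1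
    rw [← norm_neg, ← hBs] at h2
    have h3 := norm_add_le (A n - 1) (A (n + 1) - A n)
    have h4 := norm_add_le (B n) (B (n + 1) - B n)
    rw [add_sub_cancel] at h4
    rw [show A n - 1 + (A (n + 1) - A n) = A (n + 1) - 1 by ring] at h3
    simp only [hE] at h1 h2 ⊢
    linarith
  have hE0 : E 0 = 0 := by
    have h1 : A 0 = 1 := by
      simp only [hA, h0, h0']
      exact div_self (hW0 0)
    have h2 : B 0 = 0 := by simp [hB, h0, h0']
    simp [hE, h1, h2]
  have hEn : ∀ n, 1 + E n ≤ Real.exp (n * D) := by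
    intro n
    induction n with
    | zero => simp [hE0]
    | succ n ih =>
      calc 1 + E (n + 1) ≤ (1 + D) * (1 + E n) := hEs n
        _ ≤ Real.exp D * Real.exp (n * D) := by
          gcongr
          linarith [Real.add_one_le_exp D]
        _ = _ := by rw [← Real.exp_add]; push_cast; ring_nf
  have hnD : 0 ≤ n * D := by positivity
  have hexp : E n ≤ 2 * (n * D) := by
    -- `e^y - 1 ≤ 2y` for `0 ≤ y ≤ 1`, which is where `hn` enters.
    have h1 := Real.abs_exp_sub_one_le (x := n * D) (by rw [abs_of_nonneg hnD]; exact hn)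
    rw [abs_of_nonneg hnD] at h1
    linarith [hEn n, le_abs_self (Real.exp (n * D) - 1)]
  have hfin : h n - f n = (A n - 1) * f n + B n * g n := by
    conv_lhs => rw [hAB]
    ring
  rw [hfin]
  refine (norm_add_le _ _).trans ?_
  rw [norm_mul, norm_mul]
  have h2 := mul_le_mul_of_nonneg_left (hfM n) (norm_nonneg (A n - 1))
  have h3 := mul_le_mul_of_nonneg_left (hgM n) (norm_nonneg (B n))
  have h4 := mul_le_mul_of_nonneg_left hexp hM
  simp only [hE] at h4
  linarith

end IsSzegoSolution

/-! ### Upper density of `μ` where both solutions are bounded -/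

theorem norm_toCircle_sub_toCircle_le (x y : AddCircle (2 * Real.pi)) :
    ‖(AddCircle.toCircle x : ℂ) - AddCircle.toCircle y‖ ≤ dist x y := by
  obtain ⟨t, ht⟩ := QuotientAddGroup.mk_surjective (x - y)
  have hpi := Real.pi_pos.ne'
  set s : ℝ := t - round ((2 * Real.pi)⁻¹ * t) * (2 * Real.pi) with hs
  have hsxy : (s : AddCircle (2 * Real.pi)) = x - y := by
    rw [hs, AddCircle.coe_sub, ← zsmul_eq_mul, AddCircle.coe_zsmul, AddCircle.coe_period, smul_zero,
      sub_zero]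
    exact ht
  have hn : ‖x - y‖ = |s| := by
    rw [← ht]
    exact AddCircle.norm_eq (2 * Real.pi)
  have h1 : x = y + (s : AddCircle (2 * Real.pi)) := by rw [hsxy]; abel
  have h2 : (AddCircle.toCircle (s : AddCircle (2 * Real.pi)) : ℂ) =
      Complex.exp (Complex.I * s) := by
    rw [AddCircle.toCircle_apply_mk, div_self Real.two_pi_pos.ne', one_mul, Circle.coe_exp, mul_comm]
  have h3 : (AddCircle.toCircle x : ℂ) - AddCircle.toCircle y =
      AddCircle.toCircle y * (Complex.exp (Complex.I * s) - 1) := by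
    rw [← h2, mul_sub, mul_one, ← Circle.coe_mul, ← AddCircle.toCircle_add, ← h1]
  rw [h3, norm_mul, norm_toCircle, one_mul, dist_eq_norm, hn]
  exact Real.norm_exp_I_mul_ofReal_sub_one_le

/-- If the orthogonal polynomials of the first and second kind are bounded at a point, then the
measure has a finite upper density there. -/
theorem exists_measure_closedBall_le (μ : Measure (AddCircle (2 * Real.pi)))
    [IsProbabilityMeasure μ] {α : ℕ → ℂ} (h : IsMonicOrthogonal μ (szegoPoly α))
    (hα : ∀ n, ‖α n‖ ^ 2 < 1) (hs : Summable fun n => ‖α n‖ ^ 2) (x : AddCircle (2 * Real.pi))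
    (hΦ : BddAbove (Set.range fun n => ‖(szegoPoly α n).eval (AddCircle.toCircle x : ℂ)‖))
    (hΨ : BddAbove (Set.range fun n => ‖(szegoPoly (-α) n).eval (AddCircle.toCircle x : ℂ)‖)) :
    ∃ δ K : ℝ, 0 < δ ∧ ∀ r, 0 < r → r ≤ δ → μ.real (Metric.closedBall x r) ≤ K * r := by
  obtain ⟨c, hc, hprod⟩ := prod_one_sub_ge (fun n => by positivity) hα hs
  obtain ⟨M₁, hM₁⟩ := hΦ
  obtain ⟨M₂, hM₂⟩ := hΨ
  set M := max 1 (max M₁ M₂) with hMdef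
  have hM1 : 1 ≤ M := le_max_left _ _
  have hM0 : 0 < M := by linarith
  set ζ : ℂ := (AddCircle.toCircle x : ℂ)
  have hζ : ‖ζ‖ = 1 := norm_toCircle x
  set f : ℕ → ℂ := fun n => (szegoPoly α n).eval ζ with hf
  set g : ℕ → ℂ := fun n => (szegoPoly (-α) n).eval ζ with hg
  have hfM : ∀ n, ‖f n‖ ≤ M := fun n =>
    (hM₁ ⟨n, rfl⟩).trans ((le_max_left _ _).trans (le_max_right _ _))
  have hgM : ∀ n, ‖g n‖ ≤ M := fun n =>
    (hM₂ ⟨n, rfl⟩).trans ((le_max_right _ _).trans (le_max_right _ _))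
  have hsf := IsSzegoSolution.of_szegoPoly α hζ
  have hsg := IsSzegoSolution.of_szegoPoly_neg α hζ
  set f' : ℕ → ℂ := fun n => ζ ^ n * starRingEnd ℂ (f n) with hf'
  set g' : ℕ → ℂ := fun n => -(ζ ^ n * starRingEnd ℂ (g n)) with hg'
  have hfM' : ∀ n, ‖f' n‖ = ‖f n‖ := fun n => by simp [hf', hζ]
  have hgM' : ∀ n, ‖g' n‖ = ‖g n‖ := fun n => by simp [hg', hζ]
  have hW : ∀ n, 2 * c ≤ ‖f n * g' n - g n * f' n‖ := by
    intro n
    rw [IsSzegoSolution.wronskian_eq hsf hsg n]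
    have h0 : f 0 * g' 0 - g 0 * f' 0 = -2 := by
      simp [hf, hg, hf', hg', szegoPoly]; norm_num
    rw [h0, norm_mul, norm_mul, norm_pow, hζ, Complex.norm_real,
      Real.norm_of_nonneg (hc.le.trans (hprod n))]
    simp only [one_pow, one_mul, norm_neg, Complex.norm_ofNat]
    linarith [hprod n]
  -- The Wronskian is at most `2M‖f n‖`, so `f` cannot become small.
  have hflow : ∀ n, c / M ≤ ‖f n‖ := by
    intro n
    rw [div_le_iff₀ hM0]
    have h1 := (hW n).trans (norm_sub_le _ _)
    rw [norm_mul, norm_mul, hfM', hgM'] at h1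
    nlinarith [hgM n, norm_nonneg (f n)]
  have hcM : c / M ≤ M := (hflow 0).trans (hfM 0)
  -- Chosen so that the perturbation bound `2M · δM²/c` equals `c/(2M)`, half the lower bound for
  -- `‖f j‖`.
  set δ := c ^ 2 / (4 * M ^ 4) with hδ
  have hδ0 : 0 < δ := by positivity
  have hδ1 : δ * (M ^ 2 / c) ≤ 1 := by
    rw [hδ, div_mul_div_comm, div_le_one (by positivity)]
    rw [div_le_iff₀ hM0] at hcM
    nlinarith [mul_le_mul_of_nonneg_left hcM (show 0 ≤ c * M ^ 2 by positivity),
      show 0 ≤ c * M ^ 4 by positivity]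
  have key : ∀ n : ℕ, 1 ≤ n →
      μ.real (Metric.closedBall x (δ / n)) ≤ 4 * M ^ 2 / (c ^ 2 * n) := by
    intro n hn
    have hn0 : (0 : ℝ) < n := by exact_mod_cast hn
    set Q := ∑ j ∈ Finset.range n, ‖f j‖ ^ 2 with hQ
    have hQlow : n * (c / M) ^ 2 ≤ Q := by
      have : ∀ j ∈ Finset.range n, (c / M) ^ 2 ≤ ‖f j‖ ^ 2 := fun j _ => by
        gcongr
        exact hflow j
      have := Finset.card_nsmul_le_sum _ _ _ this
      rwa [Finset.card_range, nsmul_eq_mul] at this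
    have hQ0 : 0 < Q := lt_of_lt_of_le (by positivity) hQlow
    have hlow : ∀ y ∈ Metric.closedBall x (δ / n), Q / 2 ≤
        ‖∑ j ∈ Finset.range n, starRingEnd ℂ (f j) *
          (szegoPoly α j).eval (AddCircle.toCircle y : ℂ)‖ := by
      intro y hy
      have hd : ‖(AddCircle.toCircle y : ℂ) - ζ‖ ≤ δ / n :=
        (norm_toCircle_sub_toCircle_le y x).trans hy
      have hsh := IsSzegoSolution.of_szegoPoly α (norm_toCircle y)
      set u : ℕ → ℂ := fun j => (szegoPoly α j).eval (AddCircle.toCircle y : ℂ) with hu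
      have hdj : ∀ j ∈ Finset.range n, ‖u j - f j‖ ≤ ‖f j‖ / 2 := by
        intro j hj
        have hjn : (j : ℝ) ≤ n := by exact_mod_cast (Finset.mem_range.1 hj).le
        have hjd : j * (‖(AddCircle.toCircle y : ℂ) - ζ‖ * (M ^ 2 / c)) ≤ δ * (M ^ 2 / c) := by
          calc _ ≤ n * (δ / n * (M ^ 2 / c)) := by gcongr
            _ = _ := by field_simp
        have := IsSzegoSolution.norm_sub_le_of_nearby hζ hc hM0.le hsf hsg hsh
          (by simp [hu, szegoPoly]) (by simp [hf', hf, szegoPoly]) hα hfM (fun n => (hfM' n).trans_le (hfM n))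
          hgM (fun n => (hgM' n).trans_le (hgM n)) hW j (hjd.trans hδ1)
        refine this.trans ?_
        calc _ ≤ M * (2 * (δ * (M ^ 2 / c))) := by gcongr
          _ = c / M / 2 := by rw [hδ]; field_simp; norm_num
          _ ≤ _ := by gcongr; exact hflow j
      have e : ∑ j ∈ Finset.range n, starRingEnd ℂ (f j) * u j =
          (Q : ℂ) + ∑ j ∈ Finset.range n, starRingEnd ℂ (f j) * (u j - f j) := by
        rw [hQ, Complex.ofReal_sum, ← Finset.sum_add_distrib]
        refine Finset.sum_congr rfl fun j _ => ?_
        rw [Complex.ofReal_pow, ← Complex.conj_mul']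
        ring
      have herr : ‖∑ j ∈ Finset.range n, starRingEnd ℂ (f j) * (u j - f j)‖ ≤ Q / 2 := by
        rw [hQ, Finset.sum_div]
        refine (norm_sum_le _ _).trans (Finset.sum_le_sum fun j hj => ?_)
        rw [norm_mul, RCLike.norm_conj]
        nlinarith [hdj j hj, norm_nonneg (f j)]
      rw [e]
      have := norm_sub_le_norm_add (Q : ℂ)
        (∑ j ∈ Finset.range n, starRingEnd ℂ (f j) * (u j - f j))
      rw [Complex.norm_real, Real.norm_of_nonneg hQ0.le] at this
      linarith
    have hcont : Continuous fun y : AddCircle (2 * Real.pi) =>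
        ‖∑ j ∈ Finset.range n, starRingEnd ℂ (f j) *
          (szegoPoly α j).eval (AddCircle.toCircle y : ℂ)‖ ^ 2 :=
      (continuous_finsetSum _ fun j _ =>
        continuous_const.mul (continuous_eval_toCircle _)).norm.pow 2
    -- The kernel is at least `Q/2` on the ball and its square has integral at most `Q`, so the ball
    -- has mass at most `4/Q`.
    have hmarkov := mul_meas_ge_le_integral_of_nonneg (μ := μ)
      (Filter.Eventually.of_forall fun y => by positivity)
      (integrable_of_continuous_addCircle μ hcont) ((Q / 2) ^ 2)
    have hup := h.integral_norm_sq_sum_le (fun j => starRingEnd ℂ (f j)) n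
    simp only [RCLike.norm_conj] at hup
    have hsub : μ.real (Metric.closedBall x (δ / n)) ≤ μ.real {y | (Q / 2) ^ 2 ≤
        ‖∑ j ∈ Finset.range n, starRingEnd ℂ (f j) *
          (szegoPoly α j).eval (AddCircle.toCircle y : ℂ)‖ ^ 2} :=
      measureReal_mono fun y hy => by
        have := hlow y hy
        simp only [Set.mem_ofPred_eq]
        gcongr
    have h1 : (Q / 2) ^ 2 * μ.real (Metric.closedBall x (δ / n)) ≤ Q :=
      (mul_le_mul_of_nonneg_left hsub (by positivity)).trans (hmarkov.trans hup)
    have h2 : μ.real (Metric.closedBall x (δ / n)) * Q ≤ 4 := by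
      have h3 : Q * (Q * μ.real (Metric.closedBall x (δ / n))) ≤ Q * 4 := by nlinarith
      have := le_of_mul_le_mul_left h3 hQ0
      linarith
    rw [le_div_iff₀ (by positivity)]
    have h4 := (mul_le_mul_of_nonneg_left hQlow measureReal_nonneg).trans h2
    rw [div_pow, mul_div_assoc', mul_div_assoc', div_le_iff₀ (by positivity)] at h4
    linarith
  refine ⟨δ, 8 * M ^ 2 / (c ^ 2 * δ), hδ0, fun r hr hrδ => ?_⟩
  have h1 : 1 ≤ δ / r := (one_le_div hr).2 hrδ
  set n := ⌊δ / r⌋₊ with hn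
  have hn1 : 1 ≤ n := Nat.one_le_floor_iff _ |>.2 h1
  have hn0 : (1 : ℝ) ≤ n := by exact_mod_cast hn1
  have hnr : r ≤ δ / n := by
    rw [le_div_iff₀ (by linarith), mul_comm, ← le_div_iff₀ hr]
    exact Nat.floor_le (by linarith)
  have hnr' : δ / r ≤ 2 * n := by
    have := Nat.lt_floor_add_one (δ / r)
    linarith
  calc μ.real (Metric.closedBall x r) ≤ μ.real (Metric.closedBall x (δ / n)) :=
        measureReal_mono (Metric.closedBall_subset_closedBall hnr)
    _ ≤ 4 * M ^ 2 / (c ^ 2 * n) := key n hn1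
    _ ≤ 4 * M ^ 2 / (c ^ 2 * (δ / r / 2)) := by
        gcongr
        linarith
    _ = _ := by field_simp; norm_num

/-! ### Density bounds and null sets -/

/-- A measure does not charge sets of zero length on which it has finite upper density. -/
theorem measure_eq_zero_of_density_bound {X : Type*} [MetricSpace X] [MeasurableSpace X]
    [BorelSpace X] (μ : Measure X) [IsFiniteMeasure μ] {s : Set X} (hs : μH[1] s = 0)
    (h : ∀ x ∈ s, ∃ δ K : ℝ, 0 < δ ∧ ∀ r, 0 < r → r ≤ δ → μ.real (Metric.closedBall x r) ≤ K * r) :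
    μ s = 0 := by
  set G : ℕ → Set X := fun N => {x | ∀ r : ℝ, 0 < r → r ≤ 1 / ((N : ℝ) + 1) →
    μ.real (Metric.closedBall x r) ≤ ((N : ℝ) + 1) * r} with hG
  have hcov : s ⊆ ⋃ N, s ∩ G N := by
    intro x hx
    obtain ⟨δ, K, hδ, hK⟩ := h x hx
    obtain ⟨N, hN⟩ := exists_nat_ge (max (1 / δ) K)
    refine Set.mem_iUnion.2 ⟨N, hx, fun r hr hrN => ?_⟩
    have h1 : 1 / ((N : ℝ) + 1) ≤ δ := by
      rw [one_div_le (by positivity) hδ]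
      linarith [le_max_left (1 / δ) K]
    refine (hK r hr (hrN.trans h1)).trans ?_
    gcongr
    linarith [le_max_right (1 / δ) K]
  refine measure_mono_null hcov (measure_iUnion_null fun N => ?_)
  have hε : (0 : ENNReal) < ENNReal.ofReal (1 / ((N : ℝ) + 1)) / 2 := by
    refine ENNReal.div_pos (ENNReal.ofReal_pos.2 (by positivity)).ne' (by simp)
  -- On `G N` the constants are uniform: a small set meeting `G N` at `x` lies in a ball about `x`
  -- of radius just above its diameter.
  have hle : OuterMeasure.restrict (G N) μ.toOuterMeasure ≤
      OuterMeasure.mkMetric fun d => ENNReal.ofReal ((N : ℝ) + 1) * d := by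
    refine OuterMeasure.le_mkMetric _ _ _ hε fun t ht => ?_
    rw [OuterMeasure.restrict_apply]
    rcases (t ∩ G N).eq_empty_or_nonempty with he | ⟨x, hxt, hxG⟩
    · rw [he]; simp
    · have htop : Metric.ediam t ≠ ⊤ := ne_top_of_le_ne_top (by finiteness) ht
      have hsmall : (Metric.ediam t).toReal < 1 / ((N : ℝ) + 1) := by
        have h1 := ENNReal.toReal_mono (by finiteness) ht
        rw [ENNReal.toReal_div, ENNReal.toReal_ofReal (by positivity)] at h1
        have : (0 : ℝ) < 1 / ((N : ℝ) + 1) := by positivity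
        simp only [ENNReal.toReal_ofNat] at h1
        linarith
      have hbound : μ.real (t ∩ G N) ≤ ((N : ℝ) + 1) * (Metric.ediam t).toReal := by
        have hr : ∀ r, (Metric.ediam t).toReal < r → r < 1 / ((N : ℝ) + 1) →
            μ.real (t ∩ G N) ≤ ((N : ℝ) + 1) * r := by
          intro r h1 h2
          have hr0 : 0 < r := lt_of_le_of_lt ENNReal.toReal_nonneg h1
          refine le_trans (measureReal_mono ?_) (hxG r hr0 h2.le)
          intro y hy
          exact (Metric.dist_le_diam_of_mem' htop hy.1 hxt).trans h1.le
        -- The density bound needs a positive radius while the diameter may be 0, hence the limit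
        -- from above.
        have hlim : Filter.Tendsto (fun r => ((N : ℝ) + 1) * r)
            (nhdsWithin (Metric.ediam t).toReal (Set.Ioi (Metric.ediam t).toReal))
            (nhds (((N : ℝ) + 1) * (Metric.ediam t).toReal)) :=
          ((continuous_const.mul continuous_id).tendsto _).mono_left nhdsWithin_le_nhds
        refine ge_of_tendsto hlim ?_
        filter_upwards [Ioo_mem_nhdsGT hsmall] with r hr'
        exact hr r hr'.1 hr'.2
      have h2 := ENNReal.ofReal_le_ofReal hbound
      rw [ofReal_measureReal, ENNReal.ofReal_mul (by positivity), ENNReal.ofReal_toReal htop] at h2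
      exact h2
  have hH : OuterMeasure.mkMetric (fun d => ENNReal.ofReal ((N : ℝ) + 1) * d) s = 0 := by
    have h1 := OuterMeasure.mkMetric_smul (X := X) (fun d : ENNReal => d ^ (1 : ℝ))
      (c := ENNReal.ofReal ((N : ℝ) + 1)) ENNReal.ofReal_ne_top
      (ENNReal.ofReal_pos.2 (by positivity)).ne'
    have h2 : OuterMeasure.mkMetric (fun d : ENNReal => d ^ (1 : ℝ)) s = 0 := by
      rw [OuterMeasure.coe_mkMetric]
      exact hs
    have h3 : (fun d => ENNReal.ofReal ((N : ℝ) + 1) * d) =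
        ENNReal.ofReal ((N : ℝ) + 1) • (fun d : ENNReal => d ^ (1 : ℝ)) := by
      funext d; simp
    rw [h3, h1, smul_apply, h2, smul_zero]
  have h4 := hle s
  rw [hH, OuterMeasure.restrict_apply] at h4
  exact le_antisymm h4 zero_le

theorem lipschitzWith_coe_addCircle (T : ℝ) : LipschitzWith 1 ((↑) : ℝ → AddCircle T) := by
  refine LipschitzWith.of_dist_le_mul fun x y => ?_
  rw [NNReal.coe_one, one_mul, dist_eq_norm, ← AddCircle.coe_sub]
  exact (QuotientAddGroup.norm_mk_le_norm).trans_eq (Real.dist_eq x y).symm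

/-- The quotient map is 1-Lipschitz and `μH[1]` on the line is Lebesgue measure, so a fundamental
interval suffices. -/
theorem hausdorffMeasure_one_addCircle_eq_zero {T : ℝ} [Fact (0 < T)] {Z : Set (AddCircle T)}
    (hZ : MeasurableSet Z) (h : volume Z = 0) : μH[1] Z = 0 := by
  rw [AddCircle.add_projection_respects_measure T 0 hZ] at h
  have hsub : Z ⊆ ((↑) : ℝ → AddCircle T) '' (QuotientAddGroup.mk ⁻¹' Z ∩ Set.Ioc 0 (0 + T)) := by
    intro x hx
    refine ⟨AddCircle.equivIoc T 0 x, ⟨?_, (AddCircle.equivIoc T 0 x).2⟩,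
      AddCircle.coe_equivIoc⟩
    rw [Set.mem_preimage]
    exact (AddCircle.coe_equivIoc (y := x)).symm ▸ hx
  refine measure_mono_null hsub ?_
  have h1 := (lipschitzWith_coe_addCircle T).hausdorffMeasure_image_le (d := 1) zero_le_one
    (QuotientAddGroup.mk ⁻¹' Z ∩ Set.Ioc 0 (0 + T))
  rw [hausdorffMeasure_real, h, mul_zero] at h1
  exact le_antisymm h1 zero_le

/-! ### The two kinds of polynomials and the conclusion -/

theorem rotatedPoly_zero (α : ℕ → ℂ) : rotatedPoly α 0 = szegoPoly α := by
  simp [rotatedPoly]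

theorem rotatedPoly_pi (α : ℕ → ℂ) : rotatedPoly α Real.pi = szegoPoly (-α) := by
  rw [rotatedPoly]
  congr 1
  funext n
  rw [mul_comm, mul_comm Complex.I, Complex.exp_pi_mul_I]
  simp

theorem proposition3p1 (μ : Measure (AddCircle (2 * Real.pi))) [IsProbabilityMeasure μ]
    (hμ : ∀ F : Set (AddCircle (2 * Real.pi)), F.Finite → μ Fᶜ ≠ 0)
    (α : ℕ → ℂ) (hα : IsVerblunsky μ α) (A : ℝ)
    (hA : ∀ N : ℕ, 2 ≤ N →
      ∑ n ∈ Finset.range (N + 1), ((n : ℝ) + 1) * ‖α n‖ ^ 2 ≤ A * Real.log N) :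
    dimH (unboundedSet α) = 0 ∧
      ∃ T : Set (AddCircle (2 * Real.pi)), MeasurableSet T ∧ dimH T = 0 ∧
        (μ.singularPart volume) Tᶜ = 0 := by
  have hblock := block_sum_sq_le α A hA
  have hdim := dimH_unboundedSet_eq_zero α (2 * A) hblock
  have hs := summable_norm_sq_of_block_bound α (2 * A) hblock
  obtain ⟨Φ, hΦ, hrec⟩ := hα
  rw [hΦ.eq_szegoPoly hrec] at hΦ
  have hα1 := hΦ.norm_verblunsky_lt_one hμ
  set B : (ℕ → ℂ) → Set (AddCircle (2 * Real.pi)) := fun a =>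
    {x | BddAbove (Set.range fun n => ‖(szegoPoly a n).eval (AddCircle.toCircle x : ℂ)‖)} with hB
  have hBm : ∀ a, MeasurableSet (B a) := fun a =>
    measurableSet_bddAbove_range fun n => (continuous_eval_toCircle _).norm.measurable
  -- The exceptional set consists of the points where `β = 0` or `β = π` gives an unbounded radius;
  -- being defined by continuous functions, it is Borel.
  refine ⟨hdim, (B α ∩ B (-α))ᶜ, ((hBm _).inter (hBm _)).compl, ?_, ?_⟩
  · have hsub : (B α ∩ B (-α))ᶜ ⊆ ((↑) : ℝ → AddCircle (2 * Real.pi)) '' unboundedSet α := by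
      intro x hx
      set η : ℝ := (AddCircle.equivIco (2 * Real.pi) 0 x : ℝ)
      have hηx : (η : AddCircle (2 * Real.pi)) = x := AddCircle.coe_equivIco
      have hηm : η ∈ Set.Ico 0 (2 * Real.pi) := by
        have := (AddCircle.equivIco (2 * Real.pi) 0 x).2
        exact ⟨this.1, this.2.trans_eq (zero_add _)⟩
      have hexp : (AddCircle.toCircle x : ℂ) = Complex.exp (Complex.I * η) := by
        rw [← hηx, AddCircle.toCircle_apply_mk, div_self Real.two_pi_pos.ne', one_mul,
          Circle.coe_exp, mul_comm]
      refine ⟨η, ⟨hηm, ?_⟩, hηx⟩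
      rw [Set.mem_compl_iff, Set.mem_inter_iff, not_and_or] at hx
      simp only [hB, Set.mem_ofPred_eq, hexp] at hx
      rcases hx with hx | hx
      · refine ⟨0, ⟨le_rfl, Real.two_pi_pos⟩, ?_⟩
        simpa only [pruferRadius, rotatedPoly_zero] using hx
      · refine ⟨Real.pi, ⟨Real.pi_pos.le, by linarith [Real.pi_pos]⟩, ?_⟩
        simpa only [pruferRadius, rotatedPoly_pi] using hx
    refine le_antisymm ((dimH_mono hsub).trans ?_) zero_le
    exact ((lipschitzWith_coe_addCircle _).dimH_image_le _).trans hdim.le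
  · rw [compl_compl]
    -- `Z` is null for the singular part and `Zᶜ` is Lebesgue null, so the density bound is needed
    -- only on `Zᶜ`.
    obtain ⟨Z, hZm, hZ1, hZ2⟩ := Measure.mutuallySingular_singularPart μ volume
    have hH : μH[1] (B α ∩ B (-α) ∩ Zᶜ) = 0 :=
      measure_mono_null Set.inter_subset_right
        (hausdorffMeasure_one_addCircle_eq_zero hZm.compl hZ2)
    have h0 : μ (B α ∩ B (-α) ∩ Zᶜ) = 0 := measure_eq_zero_of_density_bound μ hH
      fun x hx => exists_measure_closedBall_le μ hΦ hα1 hs x hx.1.1 hx.1.2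
    refine measure_mono_null (t := Z ∪ (B α ∩ B (-α) ∩ Zᶜ)) ?_ (measure_union_null hZ1
      (le_antisymm ((Measure.singularPart_le μ volume _).trans h0.le) zero_le))
    intro x hx
    by_cases hxZ : x ∈ Z
    · exact Or.inl hxZ
    · exact Or.inr ⟨hx, hxZ⟩
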